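/- For integers $q\ge 1$ and $\ell,m,n$ let $$\mathcal K_q(\ell,m,n)=\sum_{x,y\in\mathbb Z_q^*}\mathbf e_q(\ell xy+m\overline x+n\overline y),\qquad \mathbf e_q(z)=\exp(2\pi i z/q),$$ where $\overline x$ is the inverse of $x$ modulo $q$. For integers $u,v,w$ and $L,M,N\ge 0$ let $\mathcal L=\{u+1,\dots,u+L\}$, $\mathcal M=\{v+1,\dots,v+M\}$, $\mathcal N=\{w+1,\dots,w+N\}$ and, for complex weights $\boldsymbol\alpha=(\alpha_\ell)_{\ell\in\mathcal L}$, $$\mathcal S_q(\boldsymbol\alpha;\mathcal L,\mathcal M,\mathcal N)=\sum_{\ell\in\mathcal L}\alpha_\ell\sum_{m\in\mathcal M}\sum_{n\in\mathcal N}\mathcal K_q(\ell,m,n).$$ **Theorem 1.2.** Fix a real $\varepsilon>0$ and an integer $r\ge 2$. As $Q\to\infty$, for all but at most $Q^{1-2r\varepsilon+o(1)}$ integers $q\in[Q,2Q]$, the following holds for all $\mathcal L,\mathcal M,\mathcal N$ as above and all weights $\boldsymbol\alpha_q=(\alpha_{q,\ell})_{\ell\in\mathcal L}$, which may depend on $q$,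 such that $|\alpha_{q,\ell}|\le 1$ for every $\ell\in\mathcal L$, and $\alpha_{q,\ell}=0$ whenever $\gcd(\ell,q)>1$: $$|\mathcal S_q(\boldsymbol\alpha_q;\mathcal L,\mathcal M,\mathcal N)|\le\left(L+L^{1-1/(2r)}M^{1/(2r)}\right)\left(q^{2-1/(2r)}+N^{1/2}q^{3/2}\right)q^{\varepsilon+o(1)}.$$ Here both terms $o(1)$ depend only on $\varepsilon$ and $r$ besides $Q$, and the exceptional set of $q$ does not depend on $\mathcal L,\mathcal M,\mathcal N$ or on the weights. Explicitly: for every $\eta>0$ there is $Q_0=Q_0(\varepsilon,r,\eta)$ such that for every real $Q\ge Q_0$ there is a set of at most $Q^{1-2r\varepsilon+\eta}$ integers outside of which every integer $q\in[Q,2Q]$ satisfies the bound, with $q^{\varepsilon+\eta}$ in place of $q^{\varepsilon+o(1)}$, for all such $\mathcal L,\mathcal M,\mathcal N,\boldsymbol\alpha_q$. -/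

import Mathlib

/-- The double Kloosterman sum
`K_q(ℓ, m, n) = ∑_{x, y ∈ (ℤ/qℤ)ˣ} e_q(ℓ x y + m x⁻¹ + n y⁻¹)`.
Here `ZMod.stdAddChar` is `e_q`, that is `z ↦ exp (2 π i z / q)` on `ℤ/qℤ`. -/
noncomputable def doubleKloosterman (q : ℕ) [NeZero q] (l m n : ℤ) : ℂ :=
  ∑ x : (ZMod q)ˣ, ∑ y : (ZMod q)ˣ,
    ZMod.stdAddChar ((l : ZMod q) * (x : ZMod q) * (y : ZMod q)
      + (m : ZMod q) * ((x⁻¹ : (ZMod q)ˣ) : ZMod q)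
      + (n : ZMod q) * ((y⁻¹ : (ZMod q)ˣ) : ZMod q))

/-- The set `{a + 1, …, a + A}` of `A` consecutive integers. -/
noncomputable def consecutive (a : ℤ) (A : ℕ) : Finset ℤ :=
  Finset.Icc (a + 1) (a + (A : ℤ))

/-- The weighted trilinear sum of double Kloosterman sums over
`ℓ ∈ {u + 1, …, u + L}`, `m ∈ {v + 1, …, v + M}`, `n ∈ {w + 1, …, w + N}`,
with weights `α ℓ`. -/
noncomputable def trilinearKloosterman (q : ℕ) [NeZero q] (α : ℤ → ℂ)
    (u v w : ℤ) (L M N : ℕ) : ℂ :=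
  ∑ l ∈ consecutive u L, α l *
    ∑ m ∈ consecutive v M, ∑ n ∈ consecutive w N, doubleKloosterman q l m n

/-! Inverting both variables turns the sums over m and n into geometric sums at x and y, bounded by
min(M, q/|x|) and min(N, q/|y|), where |·| is the least absolute residue. On dyadic blocks |x| ~ X,
|y| ~ Y there remains the sum over ℓ and x of |F(ℓ x̄)|, where F(t) = ∑_y b_y e_q(t ȳ) and b_y is
the geometric sum over n. If ν(t) is the number of pairs (ℓ, x) with ℓ x̄ = t, Hölder's inequality
bounds (∑ ν|F|)^(2r) by (∑ ν)^(2r-2) (∑ ν²) ∑ |F|^(2r) (`exists_sum_ratio_pow_le`).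

The second moment of ν counts solutions of ℓ₁x₂ ≡ ℓ₂x₁ mod q. For every q this is at most LX +
(LX)²/q up to q^o(1), wherever the interval of ℓ lies (`exists_card_ratioCongruences_le`). By
orthogonality, the moment of F is governed by the number of solutions of z̄₁ + … + z̄_{2r} ≡ 0 mod q
with |z_i| ≪ Y (`sum_norm_pow_le`).

Only this last count needs exceptional moduli (`exists_exceptional_moduli`). Clearing denominators,
q divides an integer numerator. A nonzero numerator has few divisors, hence serves few q. If it
vanishes, the product of the z_i is squarefull, so it equals ab² with a ∣ b; this leaves Y^(r+o(1))
products, each with Y^o(1) factorisations. The average count over q ~ Q is therefore about Y^r +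
Y^(2r)/Q. Markov's inequality with a loss Q^(2rε) gives the exceptional set, and the 2r-th root
turns that loss into q^ε. -/

/-! ### The divisor bound. -/

theorem natCast_add_one_le_mul_two_rpow {δ : ℝ} (hδ : 0 < δ) (a : ℕ) :
    (a : ℝ) + 1 ≤ (1 + 1 / (δ * Real.log 2)) * (2 : ℝ) ^ (δ * a) := by
  have hl : 0 < Real.log 2 := Real.log_pos (by norm_num)
  have h1 : 1 + δ * a * Real.log 2 ≤ (2 : ℝ) ^ (δ * a) := by
    rw [Real.rpow_def_of_pos (by norm_num)]
    have := Real.add_one_le_exp (Real.log 2 * (δ * a))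
    linarith
  have h2 : (a : ℝ) + 1 ≤ (1 + 1 / (δ * Real.log 2)) * (1 + δ * a * Real.log 2) := by
    have : (1 + 1 / (δ * Real.log 2)) * (1 + δ * a * Real.log 2)
        = 1 + a + δ * a * Real.log 2 + 1 / (δ * Real.log 2) := by field_simp; ring
    rw [this]
    have : 0 ≤ δ * a * Real.log 2 := by positivity
    have : 0 ≤ 1 / (δ * Real.log 2) := by positivity
    linarith
  exact h2.trans (mul_le_mul_of_nonneg_left h1 (by positivity))

/-- The divisor bound `τ(n) ≪ n ^ δ`. -/
theorem exists_card_divisors_le_rpow {δ : ℝ} (hδ : 0 < δ) :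
    ∃ C : ℝ, 1 ≤ C ∧ ∀ n : ℕ, (n.divisors.card : ℝ) ≤ C * (n : ℝ) ^ δ := by
  have hl : 0 < Real.log 2 := Real.log_pos (by norm_num)
  set K : ℝ := 1 + 1 / (δ * Real.log 2) with hK
  have hK1 : 1 ≤ K := by
    have : 0 ≤ 1 / (δ * Real.log 2) := by positivity
    linarith
  -- Primes p ≥ `P` satisfy p^δ ≥ 2, so a + 1 ≤ 2^a ≤ p^(δa) costs nothing; each of the at most `P`
  -- smaller primes costs a factor `K`.
  obtain ⟨P, hP⟩ := exists_nat_ge ((2 : ℝ) ^ (1 / δ))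
  refine ⟨K ^ P, one_le_pow₀ hK1, fun n => ?_⟩
  rcases eq_or_ne n 0 with rfl | hn
  · simp [hδ.ne']
  have key : ∀ p ∈ n.primeFactors, ((n.factorization p : ℝ) + 1)
      ≤ (if p < P then K else 1) * ((p : ℝ) ^ n.factorization p) ^ δ := by
    intro p hp
    have hpp := Nat.prime_of_mem_primeFactors hp
    have h2p : (2 : ℝ) ≤ p := by exact_mod_cast hpp.two_le
    set a := n.factorization p
    have e : ((p : ℝ) ^ a) ^ δ = (p : ℝ) ^ (δ * a) := by
      rw [← Real.rpow_natCast, ← Real.rpow_mul (by positivity), mul_comm]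
    rw [e]
    split_ifs with h
    · refine (natCast_add_one_le_mul_two_rpow hδ a).trans ?_
      gcongr
    · have hPp : (2 : ℝ) ^ (1 / δ) ≤ p := hP.trans (by exact_mod_cast not_lt.mp h)
      have h2 : (2 : ℝ) ≤ (p : ℝ) ^ δ := by
        calc (2 : ℝ) = ((2 : ℝ) ^ (1 / δ)) ^ δ := by
              rw [← Real.rpow_mul (by norm_num)]; field_simp; simp
          _ ≤ _ := by gcongr
      rw [one_mul, Real.rpow_mul (by positivity), Real.rpow_natCast]
      calc (a : ℝ) + 1 ≤ (2 : ℝ) ^ a := by exact_mod_cast Nat.lt_two_pow_self (n := a)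
        _ ≤ _ := by gcongr
  have hcard : (n.divisors.card : ℝ) = ∏ p ∈ n.primeFactors, ((n.factorization p : ℝ) + 1) := by
    rw [Nat.card_divisors hn]; push_cast; rfl
  have hprod : (n : ℝ) ^ δ = ∏ p ∈ n.primeFactors, ((p : ℝ) ^ n.factorization p) ^ δ := by
    rw [Real.finsetProd_rpow _ _ (fun _ _ => by positivity)]
    congr 1
    conv_lhs => rw [← Nat.prod_factorization_pow_eq_self hn]
    rw [Finsupp.prod]; push_cast; rfl
  rw [hcard, hprod]
  refine (Finset.prod_le_prod (fun _ _ => by positivity) key).trans ?_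
  rw [Finset.prod_mul_distrib]
  refine mul_le_mul_of_nonneg_right ?_ (Finset.prod_nonneg fun _ _ => by positivity)
  rw [Finset.prod_ite, Finset.prod_const, Finset.prod_const_one, mul_one]
  refine pow_le_pow_right₀ hK1 ?_
  calc _ ≤ (Finset.range P).card := Finset.card_le_card fun x hx => by
        simp only [Finset.mem_filter] at hx; simpa using hx.2
    _ = P := Finset.card_range P

/-! ### Squarefull products and the equation ∑ 1/z_i = 0. -/

/-- The integers, of either sign, dividing `n`; empty for `n = 0`. -/
noncomputable def signedDivisors (n : ℕ) : Finset ℤ :=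
  n.divisors.image (fun d : ℕ => (d : ℤ)) ∪ n.divisors.image (fun d : ℕ => -(d : ℤ))

theorem mem_signedDivisors {n : ℕ} (hn : n ≠ 0) {z : ℤ} (h : z ∣ (n : ℤ)) :
    z ∈ signedDivisors n := by
  have hd : z.natAbs ∈ n.divisors := by
    rw [Nat.mem_divisors]; exact ⟨Int.natAbs_dvd_natAbs.mpr h, hn⟩
  simp only [signedDivisors, Finset.mem_union, Finset.mem_image]
  rcases Int.natAbs_eq z with h | h
  · left; exact ⟨_, hd, h.symm⟩
  · right; exact ⟨_, hd, h.symm⟩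

theorem card_signedDivisors_le (n : ℕ) : (signedDivisors n).card ≤ 2 * n.divisors.card := by
  refine (Finset.card_union_le _ _).trans ?_
  have h1 := Finset.card_image_le (s := n.divisors) (f := fun d : ℕ => (d : ℤ))
  have h2 := Finset.card_image_le (s := n.divisors) (f := fun d : ℕ => -(d : ℤ))
  omega

/-- Take `a` to be the squarefree part of `n`. A prime p ∣ a not dividing `b` would satisfy p² ∣ a,
against squarefreeness; hence every prime of `a`, and so `a` itself, divides `b`. -/
theorem exists_eq_mul_sq_of_sq_dvd {n : ℕ}
    (h : ∀ p : ℕ, p.Prime → p ∣ n → p ^ 2 ∣ n) : ∃ a b : ℕ, n = a * b ^ 2 ∧ a ∣ b := by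
  obtain ⟨a, b, hab, ha⟩ := Nat.sq_mul_squarefree n
  refine ⟨a, b, by rw [← hab, mul_comm], ?_⟩
  rw [← Nat.prod_primeFactors_of_squarefree ha]
  refine Finset.prod_primes_dvd _ (fun p hp => (Nat.prime_of_mem_primeFactors hp).prime) ?_
  intro p hp
  have hpp := Nat.prime_of_mem_primeFactors hp
  have hpa := Nat.dvd_of_mem_primeFactors hp
  by_contra hpb
  have hcop : Nat.Coprime (p ^ 2) (b ^ 2) :=
    Nat.Coprime.pow 2 2 ((Nat.Prime.coprime_iff_not_dvd hpp).mpr hpb)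
  have h2 : p ^ 2 ∣ b ^ 2 * a := by
    rw [hab]; exact h p hpp (by rw [← hab]; exact Dvd.dvd.mul_left hpa _)
  have h3 : p * p ∣ a := by rw [← sq]; exact hcop.dvd_of_dvd_mul_left h2
  exact hpp.one_lt.ne' (Nat.isUnit_iff.mp (ha p h3))

/-- The numerator of `∑ i, 1 / z i` over the common denominator `∏ i, z i`. -/
def reciprocalNumerator {k : ℕ} (z : Fin k → ℤ) : ℤ :=
  ∑ i, ∏ j ∈ Finset.univ.erase i, z j

/-- Every term of the numerator other than the i-th contains the factor z_i. -/
theorem dvd_prod_erase_of_reciprocalNumerator_eq_zero {k : ℕ} {z : Fin k → ℤ}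
    (h : reciprocalNumerator z = 0) (i : Fin k) : z i ∣ ∏ j ∈ Finset.univ.erase i, z j := by
  have h1 : z i ∣ ∑ i' ∈ Finset.univ.erase i, ∏ j ∈ Finset.univ.erase i', z j := by
    refine Finset.dvd_sum fun i' hi' => Finset.dvd_prod_of_mem _ ?_
    simp only [Finset.mem_erase, Finset.mem_univ, and_true] at hi' ⊢
    exact hi'.symm
  have h2 := Finset.add_sum_erase Finset.univ
    (fun i' => ∏ j ∈ Finset.univ.erase i', z j) (Finset.mem_univ i)
  rw [reciprocalNumerator] at h
  rw [h] at h2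
  rw [eq_neg_of_add_eq_zero_left h2]
  exact (dvd_neg).mpr h1

/-- A prime dividing z_i divides the product of the remaining z_j as well, so it occurs at least
twice. -/
theorem sq_dvd_prod_natAbs {k : ℕ} {z : Fin k → ℤ} (h : reciprocalNumerator z = 0) {p : ℕ}
    (hp : p.Prime) (hd : p ∣ ∏ i, (z i).natAbs) : p ^ 2 ∣ ∏ i, (z i).natAbs := by
  obtain ⟨i, -, hi⟩ := (Prime.dvd_finsetProd_iff hp.prime _).mp hd
  have h1 := dvd_prod_erase_of_reciprocalNumerator_eq_zero h i
  have h2 : (z i).natAbs ∣ ∏ j ∈ Finset.univ.erase i, (z j).natAbs := by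
    have := Int.natAbs_dvd_natAbs.mpr h1
    rwa [← Int.natAbsHom_apply (∏ j ∈ _, _), map_prod] at this
  rw [← Finset.mul_prod_erase _ _ (Finset.mem_univ i), sq]
  exact mul_dvd_mul hi (hi.trans h2)

/-- The tuples of `k` nonzero integers of absolute value at most `X`. -/
noncomputable def nonzeroTuples (k X : ℕ) : Finset (Fin k → ℤ) :=
  Fintype.piFinset fun _ => (Finset.Icc (-(X : ℤ)) X).erase 0

theorem mem_nonzeroTuples {k X : ℕ} {z : Fin k → ℤ} :
    z ∈ nonzeroTuples k X ↔ ∀ i, z i ≠ 0 ∧ |z i| ≤ X := by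
  simp [nonzeroTuples, abs_le]

theorem card_nonzeroTuples (k X : ℕ) : (nonzeroTuples k X).card = (2 * X) ^ k := by
  have h : ((Finset.Icc (-(X : ℤ)) X).erase 0).card = 2 * X := by
    rw [Finset.card_erase_of_mem (by simp), Int.card_Icc]; omega
  simp [nonzeroTuples, h]

/-- The number of solutions of `∑ i, 1 / z i = 0` in `2 r` nonzero integers of size at most `X`
is `≪ X ^ (r + δ)`. -/
theorem exists_card_reciprocalNumerator_eq_zero_le (r : ℕ) {δ : ℝ} (hδ : 0 < δ) :
    ∃ C : ℝ, 1 ≤ C ∧ ∀ X : ℕ, 1 ≤ X →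
      (((nonzeroTuples (2 * r) X).filter fun z => reciprocalNumerator z = 0).card : ℝ)
        ≤ C * (X : ℝ) ^ r * (X : ℝ) ^ δ := by
  -- The divisor bound is applied once to b ≤ X^r and 2r times to ab² ≤ X^(3r), for a total exponent
  -- (r + 6r²)δ' ≤ δ.
  obtain ⟨δ', hδ'⟩ : ∃ δ' : ℝ, δ' = δ / (1 + r + 6 * r ^ 2) := ⟨_, rfl⟩
  have hδ'0 : 0 < δ' := by rw [hδ']; positivity
  obtain ⟨C, hC1, hC⟩ := exists_card_divisors_le_rpow hδ'0
  have hC0 : 0 < C := by linarith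
  refine ⟨C * (2 * C) ^ (2 * r), one_le_mul_of_one_le_of_one_le hC1
    (one_le_pow₀ (by linarith)), fun X hX => ?_⟩
  have hX1 : (1 : ℝ) ≤ X := by exact_mod_cast hX
  -- The product of the |z_i| is ab² with a ∣ b and b ≤ X^r, and each z_i is a signed divisor of it.
  set U : Finset (Fin (2 * r) → ℤ) := (Finset.Icc 1 (X ^ r)).biUnion fun b =>
    b.divisors.biUnion fun a => Fintype.piFinset fun _ => signedDivisors (a * b ^ 2) with hU
  have hsub : ((nonzeroTuples (2 * r) X).filter fun z => reciprocalNumerator z = 0) ⊆ U := by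
    intro z hz
    rw [Finset.mem_filter, mem_nonzeroTuples] at hz
    obtain ⟨hz, hz0⟩ := hz
    set P := ∏ i, (z i).natAbs with hP
    have hP0 : P ≠ 0 := Finset.prod_ne_zero_iff.mpr fun i _ => Int.natAbs_ne_zero.mpr (hz i).1
    obtain ⟨a, b, hab, hadvd⟩ := exists_eq_mul_sq_of_sq_dvd
      fun p hp hd => sq_dvd_prod_natAbs hz0 hp hd
    have hb0 : b ≠ 0 := by rintro rfl; simp at hab; exact hP0 hab
    have ha0 : a ≠ 0 := by rintro rfl; simp at hab; exact hP0 hab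
    have hPX : P ≤ X ^ (2 * r) := by
      have : P ≤ ∏ _i : Fin (2 * r), X := by
        refine Finset.prod_le_prod' fun i _ => ?_
        have := (hz i).2
        rw [Int.abs_eq_natAbs] at this
        exact_mod_cast this
      simpa using this
    have hbX : b ≤ X ^ r := by
      have : b ^ 2 ≤ (X ^ r) ^ 2 := by
        calc b ^ 2 ≤ a * b ^ 2 := Nat.le_mul_of_pos_left _ (Nat.pos_of_ne_zero ha0)
          _ = P := hab.symm
          _ ≤ X ^ (2 * r) := hPX
          _ = (X ^ r) ^ 2 := by rw [← pow_mul, mul_comm]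
      exact (Nat.pow_le_pow_iff_left two_ne_zero).mp this
    simp only [hU, Finset.mem_biUnion, Finset.mem_Icc, Nat.mem_divisors, Fintype.mem_piFinset]
    refine ⟨b, ⟨Nat.one_le_iff_ne_zero.mpr hb0, hbX⟩, a, ⟨hadvd, hb0⟩, fun i => ?_⟩
    refine mem_signedDivisors (by rw [← hab]; exact hP0) ?_
    rw [← hab, ← Int.natAbs_dvd]
    exact_mod_cast Finset.dvd_prod_of_mem _ (Finset.mem_univ i)
  have hXr : (1 : ℝ) ≤ (X : ℝ) ^ r := one_le_pow₀ hX1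
  set D1 : ℝ := C * ((X : ℝ) ^ r) ^ δ' with hD1
  set D2 : ℝ := (2 * (C * (((X : ℝ) ^ r) ^ 3) ^ δ')) ^ (2 * r) with hD2
  have hbound : (U.card : ℝ) ≤ (X : ℝ) ^ r * (D1 * D2) := by
    have h1 : ∀ b ∈ Finset.Icc 1 (X ^ r), ∀ a ∈ b.divisors,
        (((Fintype.piFinset fun _ : Fin (2 * r) => signedDivisors (a * b ^ 2)).card : ℕ) : ℝ)
          ≤ D2 := by
      intro b hb a ha
      rw [Finset.mem_Icc] at hb
      have hab : a ≤ b := Nat.divisor_le ha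
      have hbX : (b : ℝ) ≤ (X : ℝ) ^ r := by exact_mod_cast hb.2
      have haX : (a : ℝ) ≤ (X : ℝ) ^ r := le_trans (by exact_mod_cast hab) hbX
      simp only [Fintype.card_piFinset, Finset.prod_const, Finset.card_univ, Fintype.card_fin]
      push_cast
      refine pow_le_pow_left₀ (by positivity) ?_ _
      calc ((signedDivisors (a * b ^ 2)).card : ℝ) ≤ 2 * ((a * b ^ 2).divisors.card : ℝ) := by
            exact_mod_cast card_signedDivisors_le _
        _ ≤ 2 * (C * ((a * b ^ 2 : ℕ) : ℝ) ^ δ') := by gcongr; exact hC _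
        _ ≤ _ := by
            push_cast
            gcongr
            calc (a : ℝ) * b ^ 2 ≤ (X : ℝ) ^ r * ((X : ℝ) ^ r) ^ 2 := by gcongr
              _ = _ := by ring
    calc (U.card : ℝ) ≤ ∑ b ∈ Finset.Icc 1 (X ^ r), ∑ a ∈ b.divisors, D2 := by
          refine le_trans (Nat.cast_le.mpr Finset.card_biUnion_le) ?_
          push_cast
          refine Finset.sum_le_sum fun b hb => ?_
          refine le_trans (Nat.cast_le.mpr Finset.card_biUnion_le) ?_
          push_cast
          exact Finset.sum_le_sum fun a ha => h1 b hb a ha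
      _ ≤ ∑ b ∈ Finset.Icc 1 (X ^ r), D1 * D2 := by
          refine Finset.sum_le_sum fun b hb => ?_
          rw [Finset.sum_const, nsmul_eq_mul]
          rw [Finset.mem_Icc] at hb
          have hbX : (b : ℝ) ≤ (X : ℝ) ^ r := by exact_mod_cast hb.2
          refine mul_le_mul_of_nonneg_right ((hC b).trans ?_) (by positivity)
          rw [hD1]; gcongr
      _ = _ := by simp
  calc _ ≤ (U.card : ℝ) := by exact_mod_cast Finset.card_le_card hsub
    _ ≤ _ := hbound
    _ = C * (2 * C) ^ (2 * r) * (X : ℝ) ^ r *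
          (((X : ℝ) ^ r) ^ δ' * ((((X : ℝ) ^ r) ^ 3) ^ δ') ^ (2 * r)) := by
        rw [hD1, hD2]; ring
    _ = C * (2 * C) ^ (2 * r) * (X : ℝ) ^ r * (X : ℝ) ^ ((r + 6 * (r * r)) * δ') := by
        congr 1
        simp only [← Real.rpow_natCast, ← Real.rpow_mul (zero_le_one.trans hX1)]
        rw [← Real.rpow_add (by linarith)]
        congr 1; push_cast; ring
    _ ≤ _ := by
        gcongr
        · rw [hδ', mul_div_assoc', div_le_iff₀ (by positivity)]
          nlinarith

/-! ### The reciprocal congruence on average over the modulus. -/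

/-- The tuples of `k` nonzero integers of absolute value at most `X`, coprime to `q`, whose
inverses modulo `q` sum to `0`. -/
noncomputable def reciprocalSolutions (k X q : ℕ) : Finset (Fin k → ℤ) :=
  (nonzeroTuples k X).filter fun z =>
    (∀ i, IsCoprime (z i) (q : ℤ)) ∧ (q : ℤ) ∣ reciprocalNumerator z

theorem natAbs_reciprocalNumerator_le {k X : ℕ} (hX : 1 ≤ X) {z : Fin k → ℤ}
    (hz : z ∈ nonzeroTuples k X) : (reciprocalNumerator z).natAbs ≤ k * X ^ k := by
  rw [mem_nonzeroTuples] at hz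
  zify
  rw [reciprocalNumerator]
  refine (Finset.abs_sum_le_sum_abs _ _).trans ?_
  have h : ∀ i ∈ (Finset.univ : Finset (Fin k)),
      |∏ j ∈ Finset.univ.erase i, z j| ≤ (X : ℤ) ^ k := by
    intro i _
    rw [Finset.abs_prod]
    have hX' : (1 : ℤ) ≤ X := by exact_mod_cast hX
    calc ∏ j ∈ Finset.univ.erase i, |z j| ≤ ∏ j ∈ Finset.univ.erase i, (X : ℤ) :=
          Finset.prod_le_prod (fun _ _ => abs_nonneg _) fun j _ => (hz j).2
      _ = (X : ℤ) ^ (k - 1) := by simp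
      _ ≤ _ := pow_le_pow_right₀ hX' (Nat.sub_le _ _)
  simpa using Finset.sum_le_sum h

/-- Exchange the order of counting: a tuple with vanishing numerator may count for every q in `F`,
any other only for the few divisors of its numerator. -/
theorem exists_sum_card_reciprocalSolutions_le (r : ℕ) {δ : ℝ} (hδ : 0 < δ) :
    ∃ C : ℝ, 1 ≤ C ∧ ∀ X : ℕ, 1 ≤ X → ∀ F : Finset ℕ,
      ∑ q ∈ F, ((reciprocalSolutions (2 * r) X q).card : ℝ)
        ≤ C * (X : ℝ) ^ δ * (F.card * (X : ℝ) ^ r + (X : ℝ) ^ (2 * r)) := by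
  obtain ⟨C₁, hC₁1, hC₁⟩ := exists_card_reciprocalNumerator_eq_zero_le r hδ
  obtain ⟨δ', hδ'⟩ : ∃ δ' : ℝ, δ' = δ / (2 * r + 1) := ⟨_, rfl⟩
  have hδ'0 : 0 < δ' := by rw [hδ']; positivity
  obtain ⟨C₂, hC₂1, hC₂⟩ := exists_card_divisors_le_rpow hδ'0
  refine ⟨C₁ + C₂ * (2 * r : ℝ) ^ δ' * 2 ^ (2 * r), ?_, fun X hX F => ?_⟩
  · have : 0 ≤ C₂ * (2 * r : ℝ) ^ δ' * 2 ^ (2 * r) := by positivity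
    linarith
  have hX1 : (1 : ℝ) ≤ X := by exact_mod_cast hX
  set T := nonzeroTuples (2 * r) X with hT
  set τ : ℝ := C₂ * (2 * r : ℝ) ^ δ' * (X : ℝ) ^ δ with hτ
  have hτ0 : 0 ≤ τ := by positivity
  have h1 : ∀ z ∈ T, ((F.filter fun q : ℕ => (q : ℤ) ∣ reciprocalNumerator z).card : ℝ)
      ≤ (if reciprocalNumerator z = 0 then (F.card : ℝ) else 0) + τ := by
    intro z hz
    split_ifs with h0
    · have : ((F.filter fun q : ℕ => (q : ℤ) ∣ reciprocalNumerator z).card : ℝ) ≤ F.card := by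
        exact_mod_cast Finset.card_filter_le _ _
      linarith
    · rw [zero_add]
      have hsub : (F.filter fun q : ℕ => (q : ℤ) ∣ reciprocalNumerator z)
          ⊆ (reciprocalNumerator z).natAbs.divisors := by
        intro q hq
        rw [Finset.mem_filter] at hq
        rw [Nat.mem_divisors]
        exact ⟨Int.natCast_dvd.mp hq.2, Int.natAbs_ne_zero.mpr h0⟩
      have hn := natAbs_reciprocalNumerator_le hX hz
      calc _ ≤ ((reciprocalNumerator z).natAbs.divisors.card : ℝ) := by
            exact_mod_cast Finset.card_le_card hsub
        _ ≤ C₂ * ((reciprocalNumerator z).natAbs : ℝ) ^ δ' := hC₂ _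
        _ ≤ C₂ * ((2 * r : ℝ) * (X : ℝ) ^ (2 * r)) ^ δ' := by
            gcongr
            exact_mod_cast hn
        _ = C₂ * (2 * r : ℝ) ^ δ' * (X : ℝ) ^ ((2 * r) * δ') := by
            rw [Real.mul_rpow (by positivity) (by positivity), ← Real.rpow_natCast (X : ℝ),
              ← Real.rpow_mul (by positivity)]
            push_cast; ring
        _ ≤ τ := by
            rw [hτ]
            gcongr
            · rw [hδ', mul_div_assoc', div_le_iff₀ (by positivity)]
              nlinarith
  calc ∑ q ∈ F, ((reciprocalSolutions (2 * r) X q).card : ℝ)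
      ≤ ∑ q ∈ F, ((T.filter fun z => (q : ℤ) ∣ reciprocalNumerator z).card : ℝ) := by
        refine Finset.sum_le_sum fun q _ => ?_
        exact_mod_cast Finset.card_le_card
          (Finset.monotone_filter_right _ fun z _ (hz : _ ∧ _) => hz.2)
    _ = ∑ z ∈ T, ((F.filter fun q : ℕ => (q : ℤ) ∣ reciprocalNumerator z).card : ℝ) := by
        exact_mod_cast Finset.sum_card_bipartiteAbove_eq_sum_card_bipartiteBelow
          (s := F) (t := T) fun (q : ℕ) z => (q : ℤ) ∣ reciprocalNumerator z
    _ ≤ ∑ z ∈ T, ((if reciprocalNumerator z = 0 then (F.card : ℝ) else 0) + τ) :=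
        Finset.sum_le_sum h1
    _ = ((T.filter fun z => reciprocalNumerator z = 0).card : ℝ) * F.card
          + (2 * X : ℝ) ^ (2 * r) * τ := by
        rw [Finset.sum_add_distrib, ← Finset.sum_filter, Finset.sum_const, Finset.sum_const,
          hT, card_nonzeroTuples]
        simp
    _ ≤ (C₁ * (X : ℝ) ^ r * (X : ℝ) ^ δ) * F.card + (2 * X : ℝ) ^ (2 * r) * τ := by
        gcongr
        exact hC₁ X hX
    _ ≤ _ := by
        rw [hτ, mul_pow]
        have e1 : 0 ≤ C₁ * (X : ℝ) ^ δ * (X : ℝ) ^ (2 * r) := by positivity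
        have e2 : 0 ≤ C₂ * (2 * r : ℝ) ^ δ' * 2 ^ (2 * r) * (X : ℝ) ^ δ
          * (F.card * (X : ℝ) ^ r) := by positivity
        nlinarith

theorem exists_log_two_add_one_le_rpow {δ : ℝ} (hδ : 0 < δ) :
    ∃ C : ℝ, 1 ≤ C ∧ ∀ n : ℕ, 1 ≤ n → (Nat.log 2 n : ℝ) + 1 ≤ C * (n : ℝ) ^ δ := by
  have hl : 0 < Real.log 2 := Real.log_pos (by norm_num)
  refine ⟨1 + 1 / (δ * Real.log 2), le_add_of_nonneg_right (by positivity), fun n hn => ?_⟩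
  refine (natCast_add_one_le_mul_two_rpow hδ _).trans ?_
  refine mul_le_mul_of_nonneg_left ?_ (by positivity)
  rw [mul_comm δ, Real.rpow_mul (by norm_num), Real.rpow_natCast]
  gcongr
  exact_mod_cast Nat.pow_log_le_self 2 (by omega)

/-- For all but few moduli `q ∈ [Q, 2Q]`, the congruence `∑ i, 1 / z i ≡ 0 [MOD q]` in `2 r`
integers of dyadic size has nearly the expected number of solutions. -/
theorem exists_exceptional_moduli (ε : ℝ) (r : ℕ) {η : ℝ} (hη : 0 < η) :
    ∃ Q₀ : ℝ, ∀ Q : ℝ, Q₀ ≤ Q → ∃ E : Finset ℕ,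
      (E.card : ℝ) ≤ Q ^ (1 - 2 * (r : ℝ) * ε + η) ∧
        ∀ q : ℕ, Q ≤ q → (q : ℝ) ≤ 2 * Q → q ∉ E → ∀ j : ℕ, (2 : ℝ) ^ j ≤ 2 * Q →
          ((reciprocalSolutions (2 * r) (2 ^ j) q).card : ℝ)
            ≤ (((2 : ℝ) ^ j) ^ r + ((2 : ℝ) ^ j) ^ (2 * r) / Q) * Q ^ (2 * (r : ℝ) * ε) := by
  have hδ : 0 < η / 4 := by positivity
  obtain ⟨C₁, hC₁1, hC₁⟩ := exists_sum_card_reciprocalSolutions_le r hδ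
  obtain ⟨C₂, hC₂1, hC₂⟩ := exists_log_two_add_one_le_rpow hδ
  obtain ⟨Q₁, hQ₁⟩ := Filter.eventually_atTop.mp
    ((tendsto_rpow_atTop (show 0 < η / 2 by positivity)).eventually_ge_atTop
      (C₂ * (2 : ℝ) ^ (η / 4) * (3 * C₁ * (2 : ℝ) ^ (η / 4))))
  refine ⟨max 1 Q₁, fun Q hQ => ?_⟩
  have hQ1 : 1 ≤ Q := (le_max_left _ _).trans hQ
  have hQ0 : 0 < Q := by linarith
  have hlarge := hQ₁ Q ((le_max_right _ _).trans hQ)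
  set n := ⌊2 * Q⌋₊ with hn
  have hnQ : (n : ℝ) ≤ 2 * Q := Nat.floor_le (by positivity)
  have hn1 : 1 ≤ n := Nat.le_floor (by push_cast; linarith)
  set F := (Finset.range (n + 1)).filter fun q : ℕ => Q ≤ q with hF
  have hFcard : (F.card : ℝ) ≤ 3 * Q := by
    calc (F.card : ℝ) ≤ ((Finset.range (n + 1)).card : ℝ) := by
          exact_mod_cast Finset.card_filter_le _ _
      _ ≤ _ := by rw [Finset.card_range]; push_cast; linarith
  -- Up to small powers, X^r + X^(2r)/Q is the average of the count over `F`. By Markov's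
  -- inequality, exceeding it by Q^(2rε) is possible for only a proportion Q^(-2rε) of the moduli.
  set B : ℕ → ℝ := fun j =>
    (((2 : ℝ) ^ j) ^ r + ((2 : ℝ) ^ j) ^ (2 * r) / Q) * Q ^ (2 * (r : ℝ) * ε) with hB
  set E : ℕ → Finset ℕ := fun j =>
    F.filter fun q => ¬ ((reciprocalSolutions (2 * r) (2 ^ j) q).card : ℝ) ≤ B j with hE
  have hEcard : ∀ j ∈ Finset.range (Nat.log 2 n + 1),
      ((E j).card : ℝ) ≤ 3 * C₁ * (2 * Q) ^ (η / 4) * Q ^ (1 - 2 * (r : ℝ) * ε) := by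
    intro j hj
    rw [Finset.mem_range, Nat.lt_succ_iff] at hj
    have hjn : 2 ^ j ≤ n := Nat.pow_le_of_le_log (by omega) hj
    have hjQ : (2 : ℝ) ^ j ≤ 2 * Q := le_trans (by exact_mod_cast hjn) hnQ
    set X : ℝ := (2 : ℝ) ^ j with hX
    have hX0 : 0 < X := by positivity
    have hBpos : 0 < X ^ r + X ^ (2 * r) / Q := by positivity
    have hmain := hC₁ (2 ^ j) Nat.one_le_two_pow F
    push_cast at hmain
    rw [← hX] at hmain
    have hmarkov : ((E j).card : ℝ) * B j
        ≤ ∑ q ∈ F, ((reciprocalSolutions (2 * r) (2 ^ j) q).card : ℝ) := by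
      calc ((E j).card : ℝ) * B j = ∑ _q ∈ E j, B j := by rw [Finset.sum_const, nsmul_eq_mul]
        _ ≤ ∑ q ∈ E j, ((reciprocalSolutions (2 * r) (2 ^ j) q).card : ℝ) := by
            refine Finset.sum_le_sum fun q hq => ?_
            exact (not_le.mp (Finset.mem_filter.mp hq).2).le
        _ ≤ _ := Finset.sum_le_sum_of_subset_of_nonneg (Finset.filter_subset _ _)
            fun _ _ _ => Nat.cast_nonneg _
    have hupper : C₁ * X ^ (η / 4) * (F.card * X ^ r + X ^ (2 * r))
        ≤ 3 * C₁ * (2 * Q) ^ (η / 4) * Q * (X ^ r + X ^ (2 * r) / Q) := by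
      calc C₁ * X ^ (η / 4) * (F.card * X ^ r + X ^ (2 * r))
          ≤ C₁ * (2 * Q) ^ (η / 4) * (3 * Q * X ^ r + 3 * X ^ (2 * r)) := by
            gcongr
            have : 0 < X ^ (2 * r) := by positivity
            linarith
        _ = _ := by field_simp
    have hfin : ((E j).card : ℝ) * (Q ^ (2 * (r : ℝ) * ε) * (X ^ r + X ^ (2 * r) / Q))
        ≤ 3 * C₁ * (2 * Q) ^ (η / 4) * Q * (X ^ r + X ^ (2 * r) / Q) := by
      refine le_trans (le_of_eq ?_) ((hmarkov.trans hmain).trans hupper)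
      rw [hB]; ring
    rw [← mul_assoc] at hfin
    have hfin' := le_of_mul_le_mul_right hfin hBpos
    rw [Real.rpow_sub hQ0, Real.rpow_one, ← mul_div_assoc, le_div_iff₀ (by positivity)]
    exact hfin'
  refine ⟨(Finset.range (Nat.log 2 n + 1)).biUnion E, ?_, ?_⟩
  · calc (((Finset.range (Nat.log 2 n + 1)).biUnion E).card : ℝ)
        ≤ ∑ j ∈ Finset.range (Nat.log 2 n + 1), ((E j).card : ℝ) := by
          exact_mod_cast Finset.card_biUnion_le
      _ ≤ ∑ j ∈ Finset.range (Nat.log 2 n + 1),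
            3 * C₁ * (2 * Q) ^ (η / 4) * Q ^ (1 - 2 * (r : ℝ) * ε) := Finset.sum_le_sum hEcard
      _ = ((Nat.log 2 n : ℝ) + 1) * (3 * C₁ * (2 * Q) ^ (η / 4) * Q ^ (1 - 2 * (r : ℝ) * ε)) := by
          simp
      -- The budget η is spent as η/4 on the number of scales j, η/4 on the divisor bound and η/2 on
      -- the constants.
      _ ≤ (C₂ * (2 * Q) ^ (η / 4))
            * (3 * C₁ * (2 * Q) ^ (η / 4) * Q ^ (1 - 2 * (r : ℝ) * ε)) := by
          gcongr
          refine (hC₂ n hn1).trans ?_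
          gcongr
      _ = (C₂ * (2 : ℝ) ^ (η / 4) * (3 * C₁ * (2 : ℝ) ^ (η / 4)))
            * (Q ^ (η / 4) * Q ^ (η / 4)) * Q ^ (1 - 2 * (r : ℝ) * ε) := by
          rw [Real.mul_rpow (by norm_num) hQ0.le]; ring
      _ ≤ Q ^ (η / 2) * (Q ^ (η / 4) * Q ^ (η / 4)) * Q ^ (1 - 2 * (r : ℝ) * ε) := by
          gcongr
      _ = _ := by
          simp only [← Real.rpow_add hQ0]
          congr 1; ring
  · intro q hq1 hq2 hqE j hj
    by_contra hcon
    refine hqE (Finset.mem_biUnion.mpr ⟨j, ?_, ?_⟩)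
    · rw [Finset.mem_range, Nat.lt_succ_iff]
      refine Nat.le_log_of_pow_le (by norm_num) ?_
      exact Nat.le_floor (by push_cast; exact hj)
    · refine Finset.mem_filter.mpr ⟨Finset.mem_filter.mpr ⟨?_, hq1⟩, hcon⟩
      rw [Finset.mem_range, Nat.lt_succ_iff]
      exact Nat.le_floor hq2

/-! ### The congruence ℓ₁x₂ ≡ ℓ₂x₁ mod q. -/

theorem card_Ioc_filter_modEq_le {a b : ℤ} (hab : a ≤ b) {q : ℕ} (hq : 0 < q) (v : ℤ) :
    (((Finset.Ioc a b).filter fun x => x ≡ v [ZMOD q]).card : ℝ) ≤ (b - a : ℝ) / q + 1 := by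
  have h := Int.Ioc_filter_modEq_card a b (r := q) (by exact_mod_cast hq) v
  have hq' : (0 : ℚ) < q := by exact_mod_cast hq
  have h1 : ((((Finset.Ioc a b).filter fun x => x ≡ v [ZMOD q]).card : ℤ) : ℚ)
      ≤ (b - a : ℚ) / q + 1 := by
    rw [h]
    have hab' : (a : ℚ) ≤ b := by exact_mod_cast hab
    push_cast
    refine max_le ?_ (by have : 0 ≤ (b - a : ℚ) / q := div_nonneg (by linarith) hq'.le
                         linarith)
    have h2 := Int.floor_le (((b : ℚ) - v) / q)
    have h3 := Int.lt_floor_add_one (((a : ℚ) - v) / q)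
    have h4 : ((b : ℚ) - v) / q - (a - v) / q = (b - a) / q := by ring
    linarith
  exact_mod_cast h1

theorem consecutive_eq_Ioc (u : ℤ) (L : ℕ) : consecutive u L = Finset.Ioc u (u + L) := by
  ext x; simp only [consecutive, Finset.mem_Icc, Finset.mem_Ioc]; omega

theorem card_consecutive (u : ℤ) (L : ℕ) : (consecutive u L).card = L := by
  simp [consecutive_eq_Ioc]

/-- The solutions of `ℓ₁ x₂ ≡ ℓ₂ x₁ [ZMOD q]` with `ℓᵢ ∈ I` and `xᵢ ∈ D`. -/
noncomputable def ratioCongruences (q : ℕ) (I D : Finset ℤ) : Finset ((ℤ × ℤ) × ℤ × ℤ) :=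
  ((I ×ˢ I) ×ˢ (D ×ˢ D)).filter fun t => (q : ℤ) ∣ t.1.1 * t.2.2 - t.1.2 * t.2.1

theorem mem_ratioCongruences {q : ℕ} {I D : Finset ℤ} {a b x y : ℤ} :
    ((a, b), x, y) ∈ ratioCongruences q I D ↔
      (a ∈ I ∧ b ∈ I) ∧ (x ∈ D ∧ y ∈ D) ∧ (q : ℤ) ∣ a * y - b * x := by
  simp [ratioCongruences, and_assoc]

theorem card_le_of_abs_le {D : Finset ℤ} {X : ℕ} (hX : 1 ≤ X) (hD : ∀ x ∈ D, |x| ≤ X) :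
    (D.card : ℝ) ≤ 3 * X := by
  have h1 : D ⊆ Finset.Icc (-(X : ℤ)) X := fun x hx => by
    rw [Finset.mem_Icc]; exact abs_le.mp (hD x hx)
  have h2 := Finset.card_le_card h1
  rw [Int.card_Icc] at h2
  have h3 : D.card ≤ 3 * X := by omega
  exact_mod_cast h3

/-- The bound for `ratioCongruences` when the interval is longer than the modulus. -/
theorem card_ratioCongruences_le_of_le {q : ℕ} (hq : 1 ≤ q) {X : ℕ} (hX : 1 ≤ X) {D : Finset ℤ}
    (hD : ∀ x ∈ D, |x| ≤ X ∧ IsCoprime x (q : ℤ)) {u : ℤ} {L : ℕ} (hL : q ≤ L) {I : Finset ℤ}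
    (hI : I ⊆ consecutive u L) :
    ((ratioCongruences q I D).card : ℝ) ≤ 18 * ((L : ℝ) ^ 2 * (X : ℝ) ^ 2 / q) := by
  have hq0 : (0 : ℝ) < q := by exact_mod_cast hq
  have hLq : 1 ≤ (L : ℝ) / q := by rw [one_le_div hq0]; exact_mod_cast hL
  have hIcard : (I.card : ℝ) ≤ L := by
    exact_mod_cast (Finset.card_le_card hI).trans_eq (card_consecutive u L)
  have hDcard := card_le_of_abs_le hX fun x hx => (hD x hx).1
  have hmaps : ∀ t ∈ ratioCongruences q I D,
      (fun t : (ℤ × ℤ) × ℤ × ℤ => (t.1.1, t.2)) t ∈ I ×ˢ (D ×ˢ D) := by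
    rintro ⟨⟨a, b⟩, x, y⟩ ht
    rw [mem_ratioCongruences] at ht
    simp [ht.1.1, ht.2.1.1, ht.2.1.2]
  -- Since x is invertible, ℓ₁, x, y fix the class of ℓ₂ mod q, which has at most L/q + 1 ≤ 2L/q
  -- members in the interval.
  have hfib : ∀ c ∈ I ×ˢ (D ×ˢ D), (((ratioCongruences q I D).filter
      fun t => (t.1.1, t.2) = c).card : ℝ) ≤ 2 * (L / q) := by
    rintro ⟨a, x, y⟩ hc
    simp only [Finset.mem_product] at hc
    obtain ⟨s, t, hst⟩ := (hD x hc.2.1).2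
    have hle : ((ratioCongruences q I D).filter fun t => (t.1.1, t.2) = (a, x, y)).card
        ≤ ((Finset.Ioc u (u + L)).filter fun b => b ≡ a * y * s [ZMOD q]).card := by
      refine Finset.card_le_card_of_injOn (fun t => t.1.2) ?_ ?_
      · rintro ⟨⟨a', b⟩, x', y'⟩ h
        rw [Finset.mem_coe, Finset.mem_filter, mem_ratioCongruences] at h
        simp only [Prod.mk.injEq] at h
        obtain ⟨⟨⟨-, hb⟩, -, hdvd⟩, rfl, rfl, rfl⟩ := h
        have hb' := hI hb
        rw [consecutive_eq_Ioc] at hb'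
        rw [Finset.mem_coe, Finset.mem_filter]
        refine ⟨hb', ?_⟩
        rw [Int.modEq_iff_dvd]
        have : a' * y' * s - b = (a' * y' - b * x') * s - b * t * q := by
          linear_combination b * hst
        rw [this]
        exact dvd_sub (Dvd.dvd.mul_right hdvd _) (dvd_mul_left _ _)
      · rintro ⟨⟨a', b⟩, x', y'⟩ h ⟨⟨a'', b''⟩, x'', y''⟩ h' e
        simp only [Finset.mem_coe, Finset.mem_filter, Prod.mk.injEq] at h h' e ⊢
        obtain ⟨-, rfl, rfl, rfl⟩ := h
        obtain ⟨-, rfl, rfl, rfl⟩ := h'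
        exact ⟨⟨rfl, e⟩, rfl, rfl⟩
    have hclass := card_Ioc_filter_modEq_le (a := u) (b := u + L) (by omega) hq (a * y * s)
    push_cast at hclass
    calc _ ≤ _ := by exact_mod_cast hle
      _ ≤ (u + L - u : ℝ) / q + 1 := hclass
      _ = L / q + 1 := by ring
      _ ≤ _ := by linarith
  calc ((ratioCongruences q I D).card : ℝ)
      = ∑ c ∈ I ×ˢ (D ×ˢ D), (((ratioCongruences q I D).filter
          fun t => (t.1.1, t.2) = c).card : ℝ) := by
        exact_mod_cast Finset.card_eq_sum_card_fiberwise hmaps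
    _ ≤ ∑ c ∈ I ×ˢ (D ×ˢ D), 2 * (L / q : ℝ) := Finset.sum_le_sum hfib
    _ = (I.card * (D.card * D.card)) * (2 * (L / q)) := by
        simp [Finset.card_product]
    _ ≤ (L * ((3 * X) * (3 * X))) * (2 * (L / q)) := by gcongr
    _ = _ := by ring

/-- If ℓ₁ = ℓ₂, this common value is invertible and cancels, so x₁ ≡ x₂ and then x₁ = x₂. This is
where coprimality of ℓ to q enters. -/
theorem card_ratioCongruences_diagonal_le {q : ℕ} {X : ℕ} (hX : 1 ≤ X)
    {D : Finset ℤ} (hD : ∀ x ∈ D, |x| ≤ X)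
    (hDinj : ∀ x ∈ D, ∀ y ∈ D, (q : ℤ) ∣ x - y → x = y) {u : ℤ} {L : ℕ} {I : Finset ℤ}
    (hI : I ⊆ consecutive u L) (hIq : ∀ l ∈ I, IsCoprime l (q : ℤ)) :
    (((ratioCongruences q I D).filter fun t => t.1.1 = t.1.2).card : ℝ) ≤ 3 * (L * X) := by
  have hle : ((ratioCongruences q I D).filter fun t => t.1.1 = t.1.2).card
      ≤ (I ×ˢ D).card := by
    refine Finset.card_le_card_of_injOn (fun t => (t.1.1, t.2.1)) ?_ ?_
    · rintro ⟨⟨a, b⟩, x, y⟩ h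
      rw [Finset.mem_coe, Finset.mem_filter, mem_ratioCongruences] at h
      simp [h.1.1.1, h.1.2.1.1]
    · have key : ∀ a b x y, ((a, b), x, y) ∈
          (ratioCongruences q I D).filter (fun t => t.1.1 = t.1.2) → b = a ∧ y = x := by
        intro a b x y h
        rw [Finset.mem_filter, mem_ratioCongruences] at h
        obtain ⟨⟨⟨ha, -⟩, ⟨hx, hy⟩, hd⟩, rfl : a = b⟩ := h
        refine ⟨rfl, hDinj y hy x hx ?_⟩
        rw [← mul_sub] at hd
        exact (hIq a ha).symm.dvd_of_dvd_mul_left hd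
      rintro ⟨⟨a, b⟩, x, y⟩ h ⟨⟨a', b'⟩, x', y'⟩ h' e
      obtain ⟨rfl, rfl⟩ := key _ _ _ _ h
      obtain ⟨rfl, rfl⟩ := key _ _ _ _ h'
      simp only [Prod.mk.injEq] at e ⊢
      exact ⟨⟨e.1, e.1⟩, e.2, e.2⟩
  have hIcard : (I.card : ℝ) ≤ L := by
    exact_mod_cast (Finset.card_le_card hI).trans_eq (card_consecutive u L)
  calc _ ≤ ((I ×ˢ D).card : ℝ) := by exact_mod_cast hle
    _ = I.card * D.card := by rw [Finset.card_product]; push_cast; rfl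
    _ ≤ L * (3 * X) := by gcongr; exact card_le_of_abs_le hX hD
    _ = _ := by ring

/-- Shifting ℓ by u makes the bound independent of the position of the interval. With s = x₂ - x₁
and p = (ℓ₁ - u)x₂ - (ℓ₂ - u)x₁, the congruence says p ≡ -us mod q, so there are few triples (ℓ₁, s,
p). Such a triple determines the nonzero integer p - (ℓ₁ - u)s = x₁(ℓ₁ - ℓ₂), of which x₁ is a
divisor; x₁ then determines x₂ and ℓ₂. -/
theorem card_ratioCongruences_offDiagonal_le {q : ℕ} (hq : 1 ≤ q) {X : ℕ} (hX : 1 ≤ X)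
    {D : Finset ℤ} (hD : ∀ x ∈ D, x ≠ 0 ∧ |x| ≤ X) {u : ℤ} {L : ℕ} {I : Finset ℤ}
    (hI : I ⊆ consecutive u L) {τ : ℝ}
    (hτ : ∀ n : ℕ, n ≤ 4 * L * X → ((signedDivisors n).card : ℝ) ≤ τ) :
    (((ratioCongruences q I D).filter fun t => t.1.1 ≠ t.1.2).card : ℝ)
      ≤ 20 * (L * X + (L : ℝ) ^ 2 * (X : ℝ) ^ 2 / q) * τ := by
  have hq0 : (0 : ℝ) < q := by exact_mod_cast hq
  have hX1 : (1 : ℝ) ≤ X := by exact_mod_cast hX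
  have hτ0 : 0 ≤ τ := le_trans (Nat.cast_nonneg _) (hτ 0 (Nat.zero_le _))
  have hIcard : (I.card : ℝ) ≤ L := by
    exact_mod_cast (Finset.card_le_card hI).trans_eq (card_consecutive u L)
  have hImem : ∀ l ∈ I, 0 ≤ l - u ∧ l - u ≤ L := by
    intro l hl
    have := hI hl
    rw [consecutive_eq_Ioc, Finset.mem_Ioc] at this
    omega
  set S := (ratioCongruences q I D).filter fun t => t.1.1 ≠ t.1.2 with hS
  have hSmem : ∀ {a b x y}, ((a, b), x, y) ∈ S ↔ ((a ∈ I ∧ b ∈ I) ∧ (x ∈ D ∧ y ∈ D) ∧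
      (q : ℤ) ∣ a * y - b * x) ∧ a ≠ b := by
    intro a b x y
    rw [hS, Finset.mem_filter, mem_ratioCongruences]
  -- The extra -1 lets the half-open interval contain -2LX.
  set P : Finset ℤ := Finset.Ioc (-(2 * L * X : ℤ) - 1) (2 * L * X) with hP
  set f : (ℤ × ℤ) × ℤ × ℤ → ℤ × ℤ × ℤ := fun t =>
    (t.1.1, t.2.2 - t.2.1, (t.1.1 - u) * t.2.2 - (t.1.2 - u) * t.2.1) with hf
  set B : Finset (ℤ × ℤ × ℤ) := I ×ˢ ((Finset.Icc (-(2 * X : ℤ)) (2 * X) ×ˢ P).filter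
    fun c => c.2 ≡ -u * c.1 [ZMOD q]) with hB
  have hmaps : ∀ t ∈ S, f t ∈ B := by
    rintro ⟨⟨a, b⟩, x, y⟩ ht
    rw [hSmem] at ht
    obtain ⟨⟨⟨ha, hb⟩, ⟨hx, hy⟩, hd⟩, -⟩ := ht
    have hx' := abs_le.mp (hD x hx).2
    have hy' := abs_le.mp (hD y hy).2
    have h1 : |(a - u) * y| ≤ L * X := by
      rw [abs_mul]
      refine mul_le_mul ?_ (hD y hy).2 (abs_nonneg _) (by positivity)
      rw [abs_of_nonneg (hImem a ha).1]; exact (hImem a ha).2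
    have h2 : |(b - u) * x| ≤ L * X := by
      rw [abs_mul]
      refine mul_le_mul ?_ (hD x hx).2 (abs_nonneg _) (by positivity)
      rw [abs_of_nonneg (hImem b hb).1]; exact (hImem b hb).2
    rw [abs_le] at h1 h2
    simp only [hf, hB, hP, Finset.mem_product, Finset.mem_filter, Finset.mem_Icc,
      Finset.mem_Ioc]
    refine ⟨ha, ⟨⟨by omega, by omega⟩, ?_, ?_⟩, ?_⟩
    · nlinarith [h1.1, h2.2]
    · nlinarith [h1.2, h2.1]
    · rw [Int.modEq_iff_dvd]
      have : -u * (y - x) - ((a - u) * y - (b - u) * x) = -(a * y - b * x) := by ring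
      rw [this]
      exact (dvd_neg).mpr hd
  have hfib : ∀ c ∈ B, ((S.filter fun t => f t = c).card : ℝ) ≤ τ := by
    rintro ⟨a, s, p⟩ hc
    simp only [hB, hP, Finset.mem_product, Finset.mem_filter, Finset.mem_Icc,
      Finset.mem_Ioc] at hc
    obtain ⟨ha, ⟨⟨hs1, hs2⟩, hp1, hp2⟩, -⟩ := hc
    have hn : (p - (a - u) * s).natAbs ≤ 4 * L * X := by
      have h1 : |(a - u) * s| ≤ L * (2 * X) := by
        rw [abs_mul]
        refine mul_le_mul ?_ (abs_le.mpr ⟨hs1, hs2⟩) (abs_nonneg _) (by positivity)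
        rw [abs_of_nonneg (hImem a ha).1]; exact (hImem a ha).2
      rw [abs_le] at h1
      zify
      rw [abs_le]
      constructor <;> nlinarith [h1.1, h1.2]
    refine le_trans ?_ (hτ _ hn)
    have key : ∀ a' b x y, ((a', b), x, y) ∈ S.filter (fun t => f t = (a, s, p)) →
        a' = a ∧ y = x + s ∧ (b - u) * x = (a - u) * (x + s) - p ∧ x ≠ 0 ∧ b ≠ a := by
      intro a' b x y h
      rw [Finset.mem_filter, hSmem] at h
      simp only [hf, Prod.mk.injEq] at h
      obtain ⟨⟨⟨-, ⟨hx, -⟩, -⟩, hab⟩, rfl, rfl, rfl⟩ := h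
      exact ⟨rfl, by ring, by ring, (hD x hx).1, hab.symm⟩
    have hle : (S.filter fun t => f t = (a, s, p)).card
        ≤ (signedDivisors (p - (a - u) * s).natAbs).card := by
      refine Finset.card_le_card_of_injOn (fun t => t.2.1) ?_ ?_
      · rintro ⟨⟨a', b⟩, x, y⟩ h
        obtain ⟨rfl, -, hbx, hx0, hba⟩ := key _ _ _ _ h
        have e : p - (a' - u) * s = x * (a' - b) := by linear_combination hbx
        refine Finset.mem_coe.mpr (mem_signedDivisors ?_ ?_)
        · rw [e]
          exact Int.natAbs_ne_zero.mpr (mul_ne_zero hx0 (sub_ne_zero.mpr hba.symm))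
        · rw [Int.dvd_natAbs, e]
          exact dvd_mul_right _ _
      · rintro ⟨⟨a', b⟩, x, y⟩ h ⟨⟨a'', b''⟩, x'', y''⟩ h' e
        obtain ⟨rfl, rfl, hbx, hx0, -⟩ := key _ _ _ _ h
        obtain ⟨rfl, rfl, hbx', -, -⟩ := key _ _ _ _ h'
        simp only at e
        subst e
        have : b - u = b'' - u := mul_right_cancel₀ hx0 (hbx.trans hbx'.symm)
        have : b = b'' := by omega
        rw [this]
    exact_mod_cast hle
  have hBcard : (B.card : ℝ) ≤ L * (5 * X * (4 * L * X / q + 2)) := by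
    have h1 : ((((Finset.Icc (-(2 * X : ℤ)) (2 * X) ×ˢ P).filter
        fun c => c.2 ≡ -u * c.1 [ZMOD q]).card : ℕ) : ℝ) ≤ 5 * X * (4 * L * X / q + 2) := by
      rw [Finset.card_filter, Finset.sum_product]
      push_cast
      calc _ ≤ ∑ s ∈ Finset.Icc (-(2 * X : ℤ)) (2 * X), (4 * L * X / q + 2 : ℝ) := by
            refine Finset.sum_le_sum fun s _ => ?_
            have h := card_Ioc_filter_modEq_le (a := -(2 * L * X : ℤ) - 1) (b := 2 * L * X)
              (by have : (0 : ℤ) ≤ 2 * L * X := by positivity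
                  linarith) hq (-u * s)
            rw [Finset.card_filter] at h
            push_cast at h
            refine h.trans ?_
            have : (2 * L * X - (-(2 * L * X) - 1) : ℝ) / q = 4 * L * X / q + 1 / q := by ring
            rw [this]
            have : (1 : ℝ) / q ≤ 1 := by rw [div_le_one hq0]; exact_mod_cast hq
            linarith
        _ = ((Finset.Icc (-(2 * X : ℤ)) (2 * X)).card : ℝ) * (4 * L * X / q + 2) := by
            rw [Finset.sum_const, nsmul_eq_mul]
        _ ≤ _ := by
            gcongr
            rw [Int.card_Icc]
            have : (2 * (X : ℤ) + 1 - -(2 * X)).toNat ≤ 5 * X := by omega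
            exact_mod_cast this
    rw [hB, Finset.card_product]
    push_cast
    gcongr
  calc (S.card : ℝ) = ∑ c ∈ B, ((S.filter fun t => f t = c).card : ℝ) := by
        exact_mod_cast Finset.card_eq_sum_card_fiberwise hmaps
    _ ≤ ∑ _c ∈ B, τ := Finset.sum_le_sum hfib
    _ = B.card * τ := by rw [Finset.sum_const, nsmul_eq_mul]
    _ ≤ (L * (5 * X * (4 * L * X / q + 2))) * τ := by gcongr
    _ ≤ _ := by
        refine mul_le_mul_of_nonneg_right ?_ hτ0
        have e : (L : ℝ) * (5 * X * (4 * L * X / q + 2))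
          = 20 * ((L : ℝ) ^ 2 * (X : ℝ) ^ 2 / q) + 10 * (L * X) := by ring
        rw [e]
        have : (0 : ℝ) ≤ L * X := by positivity
        linarith

/-- The congruence `ℓ₁ x₂ ≡ ℓ₂ x₁` modulo `q`, with `ℓᵢ` in an arbitrary interval of length `L`
and `|xᵢ| ≤ X`, has at most about `L X + (L X)² / q` solutions coprime to `q`. -/
theorem exists_card_ratioCongruences_le {δ : ℝ} (hδ : 0 < δ) :
    ∃ C : ℝ, 1 ≤ C ∧ ∀ q : ℕ, 1 ≤ q → ∀ X : ℕ, 1 ≤ X → X ≤ q → ∀ D : Finset ℤ,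
      (∀ x ∈ D, x ≠ 0 ∧ |x| ≤ X ∧ IsCoprime x (q : ℤ)) →
      (∀ x ∈ D, ∀ y ∈ D, (q : ℤ) ∣ x - y → x = y) → ∀ (u : ℤ) (L : ℕ) (I : Finset ℤ),
      I ⊆ consecutive u L → (∀ l ∈ I, IsCoprime l (q : ℤ)) →
      ((ratioCongruences q I D).card : ℝ)
        ≤ C * (q : ℝ) ^ δ * (L * X + (L : ℝ) ^ 2 * (X : ℝ) ^ 2 / q) := by
  obtain ⟨C, hC1, hC⟩ := exists_card_divisors_le_rpow (half_pos hδ)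
  refine ⟨18 + 40 * C * (4 : ℝ) ^ (δ / 2), ?_, ?_⟩
  · have : 0 ≤ 40 * C * (4 : ℝ) ^ (δ / 2) := by positivity
    linarith
  intro q hq X hX hXq D hD hDinj u L I hI hIq
  have hq1 : (1 : ℝ) ≤ q := by exact_mod_cast hq
  have hqδ : (1 : ℝ) ≤ (q : ℝ) ^ δ := Real.one_le_rpow hq1 hδ.le
  set W : ℝ := L * X + (L : ℝ) ^ 2 * (X : ℝ) ^ 2 / q with hW
  have hW0 : 0 ≤ W := by positivity
  have hC4 : 0 ≤ 40 * C * (4 : ℝ) ^ (δ / 2) := by positivity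
  -- The divisor bound is a power of q only if LX is polynomially bounded in q; longer intervals are
  -- covered by counting residue classes.
  rcases le_total q L with hL | hL
  · refine (card_ratioCongruences_le_of_le hq hX (fun x hx => (hD x hx).2) hL hI).trans ?_
    have h1 : (L : ℝ) ^ 2 * (X : ℝ) ^ 2 / q ≤ W := by
      rw [hW]; have : (0 : ℝ) ≤ L * X := by positivity
      linarith
    calc _ ≤ 18 * 1 * W := by linarith
      _ ≤ (18 + 40 * C * (4 : ℝ) ^ (δ / 2)) * (q : ℝ) ^ δ * W := by gcongr; linarith
  · set τ : ℝ := 2 * (C * (4 * (q : ℝ) ^ 2) ^ (δ / 2)) with hτ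
    have hτn : ∀ n : ℕ, n ≤ 4 * L * X → ((signedDivisors n).card : ℝ) ≤ τ := by
      intro n hn
      calc ((signedDivisors n).card : ℝ) ≤ 2 * (n.divisors.card : ℝ) := by
            exact_mod_cast card_signedDivisors_le n
        _ ≤ 2 * (C * (n : ℝ) ^ (δ / 2)) := by gcongr; exact hC n
        _ ≤ _ := by
            rw [hτ]
            gcongr
            have : n ≤ 4 * q ^ 2 := hn.trans (by
              rw [sq, mul_assoc]; exact Nat.mul_le_mul_left _ (Nat.mul_le_mul hL hXq))
            exact_mod_cast this
    have hτe : τ = 2 * C * (4 : ℝ) ^ (δ / 2) * (q : ℝ) ^ δ := by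
      rw [hτ, Real.mul_rpow (by norm_num) (by positivity), ← Real.rpow_natCast (q : ℝ),
        ← Real.rpow_mul (by positivity)]
      have : ((2 : ℕ) : ℝ) * (δ / 2) = δ := by push_cast; ring
      rw [this]; ring
    have h1 := card_ratioCongruences_diagonal_le (q := q) hX
      (fun x hx => (hD x hx).2.1) hDinj hI hIq
    have h2 := card_ratioCongruences_offDiagonal_le hq hX
      (fun x hx => ⟨(hD x hx).1, (hD x hx).2.1⟩) hI hτn
    have h3 : ((ratioCongruences q I D).card : ℝ)
        = (((ratioCongruences q I D).filter fun t => t.1.1 = t.1.2).card : ℝ)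
          + (((ratioCongruences q I D).filter fun t => t.1.1 ≠ t.1.2).card : ℝ) := by
      exact_mod_cast (Finset.card_filter_add_card_filter_not _).symm
    have h4 : (L * X : ℝ) ≤ W := by
      rw [hW]; have : (0 : ℝ) ≤ (L : ℝ) ^ 2 * (X : ℝ) ^ 2 / q := by positivity
      linarith
    have h5 : W ≤ (q : ℝ) ^ δ * W := le_mul_of_one_le_left hW0 hqδ
    rw [h3]
    calc _ ≤ 3 * W + 20 * W * τ := by linarith
      _ = 3 * W + 40 * C * (4 : ℝ) ^ (δ / 2) * ((q : ℝ) ^ δ * W) := by rw [hτe]; ring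
      _ ≤ 18 * ((q : ℝ) ^ δ * W) + 40 * C * (4 : ℝ) ^ (δ / 2) * ((q : ℝ) ^ δ * W) := by
          linarith
      _ = _ := by ring

/-! ### Geometric sums over intervals. -/

theorem sub_one_mul_sum_consecutive {q : ℕ} [NeZero q] (v : ℤ) (M : ℕ) (x : ZMod q) :
    (ZMod.stdAddChar x - 1) * ∑ m ∈ consecutive v M, ZMod.stdAddChar ((m : ZMod q) * x)
      = ZMod.stdAddChar (((v + M + 1 : ℤ) : ZMod q) * x)
        - ZMod.stdAddChar (((v + 1 : ℤ) : ZMod q) * x) := by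
  induction M with
  | zero => simp [consecutive]
  | succ M ih =>
    have h : consecutive v (M + 1) = insert (v + M + 1) (consecutive v M) := by
      ext y; simp only [consecutive, Finset.mem_Icc, Finset.mem_insert]; push_cast; omega
    rw [h, Finset.sum_insert (by simp [consecutive]), mul_add, ih, sub_mul, ← AddChar.map_add_eq_mul]
    have e : x + ((v + M + 1 : ℤ) : ZMod q) * x = ((v + (M + 1 : ℕ) + 1 : ℤ) : ZMod q) * x := by
      push_cast; ring
    rw [e]; ring

/-- The norm is 2|sin(πa/q)| with |a| ≤ q/2, and Jordan's inequality |sin θ| ≥ 2|θ|/π holds for |θ|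
≤ π/2. -/
theorem four_mul_abs_valMinAbs_div_le {q : ℕ} [NeZero q] (x : ZMod q) :
    4 * (x.valMinAbs.natAbs : ℝ) / q ≤ ‖ZMod.stdAddChar x - 1‖ := by
  have hq0 : (0 : ℝ) < q := by exact_mod_cast NeZero.pos q
  set a := x.valMinAbs with ha
  have hx : ZMod.stdAddChar x = Complex.exp (Complex.I * ((2 * Real.pi * a / q : ℝ) : ℂ)) := by
    conv_lhs => rw [← ZMod.coe_valMinAbs x]
    rw [ZMod.stdAddChar_coe]
    congr 1; push_cast; ring
  have haq : |(a : ℝ)| ≤ q / 2 := by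
    have := ZMod.natAbs_valMinAbs_le x
    have h2 : 2 * a.natAbs ≤ q := by omega
    have h3 : 2 * |(a : ℝ)| ≤ q := by
      rw [← Int.cast_abs, Int.abs_eq_natAbs]; exact_mod_cast h2
    linarith
  rw [hx, Complex.norm_exp_I_mul_ofReal_sub_one, norm_mul, Real.norm_eq_abs, Real.norm_eq_abs]
  have harg : 2 * Real.pi * (a : ℝ) / q / 2 = Real.pi * a / q := by ring
  have habs : |Real.pi * (a : ℝ) / q| = Real.pi * |(a : ℝ)| / q := by
    rw [abs_div, abs_mul, abs_of_pos Real.pi_pos, abs_of_pos hq0]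
  have h := Real.mul_abs_le_abs_sin (x := Real.pi * a / q) (by
    rw [habs, div_le_div_iff₀ hq0 (by norm_num)]
    nlinarith [Real.pi_pos])
  rw [harg]
  have e : ((a.natAbs : ℕ) : ℝ) = |(a : ℝ)| := by
    rw [← Int.cast_abs, Int.abs_eq_natAbs]; simp
  rw [e, abs_of_pos (show (0 : ℝ) < 2 by norm_num)]
  rw [habs] at h
  have : 2 / Real.pi * (Real.pi * |(a : ℝ)| / q) = 2 * |(a : ℝ)| / q := by
    field_simp
  rw [this] at h
  calc 4 * |(a : ℝ)| / q = 2 * (2 * |(a : ℝ)| / q) := by ring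
    _ ≤ _ := by gcongr

theorem norm_sum_consecutive_le_card {q : ℕ} [NeZero q] (v : ℤ) (M : ℕ) (x : ZMod q) :
    ‖∑ m ∈ consecutive v M, ZMod.stdAddChar ((m : ZMod q) * x)‖ ≤ M := by
  refine (norm_sum_le _ _).trans ?_
  simp [AddChar.norm_apply, card_consecutive]

theorem norm_sum_consecutive_le_div {q : ℕ} [NeZero q] (v : ℤ) (M : ℕ) {x : ZMod q}
    (hx : x ≠ 0) :
    ‖∑ m ∈ consecutive v M, ZMod.stdAddChar ((m : ZMod q) * x)‖ ≤ q / x.valMinAbs.natAbs := by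
  have hq0 : (0 : ℝ) < q := by exact_mod_cast NeZero.pos q
  have ha : (0 : ℝ) < x.valMinAbs.natAbs := by
    have : x.valMinAbs ≠ 0 := by rwa [Ne, ZMod.valMinAbs_eq_zero]
    exact_mod_cast Int.natAbs_pos.mpr this
  have h1 := congrArg norm (sub_one_mul_sum_consecutive v M x)
  rw [norm_mul] at h1
  have h2 := norm_sub_le (ZMod.stdAddChar (((v + M + 1 : ℤ) : ZMod q) * x))
    (ZMod.stdAddChar (((v + 1 : ℤ) : ZMod q) * x))
  rw [AddChar.norm_apply, AddChar.norm_apply] at h2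
  have h3 := four_mul_abs_valMinAbs_div_le x
  set T := ‖∑ m ∈ consecutive v M, ZMod.stdAddChar ((m : ZMod q) * x)‖
  have h4 : 4 * (x.valMinAbs.natAbs : ℝ) / q * T ≤ 2 := by
    calc _ ≤ ‖ZMod.stdAddChar x - 1‖ * T := by gcongr
      _ ≤ _ := by rw [h1]; linarith
  rw [le_div_iff₀ ha]
  rw [div_mul_eq_mul_div, div_le_iff₀ hq0] at h4
  linarith

/-! ### Hölder's inequality and the 2r-th moment. -/

/-- Hölder with exponent r against the weight `w`, followed by Cauchy–Schwarz to separate `w` from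
f^r. -/
theorem sum_mul_pow_two_mul_le {ι : Type*} (s : Finset ι) {r : ℕ} (hr : 1 ≤ r) (w f : ι → ℝ)
    (hw : ∀ i, 0 ≤ w i) (hf : ∀ i, 0 ≤ f i) :
    (∑ i ∈ s, w i * f i) ^ (2 * r)
      ≤ (∑ i ∈ s, w i) ^ (2 * r - 2) * (∑ i ∈ s, w i ^ 2) * ∑ i ∈ s, f i ^ (2 * r) := by
  have hr0 : (r : ℝ) ≠ 0 := by positivity
  have hS : 0 ≤ ∑ i ∈ s, w i := Finset.sum_nonneg fun i _ => hw i
  have hT : 0 ≤ ∑ i ∈ s, w i * f i ^ r :=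
    Finset.sum_nonneg fun i _ => mul_nonneg (hw i) (pow_nonneg (hf i) _)
  have h0 : 0 ≤ ∑ i ∈ s, w i * f i := Finset.sum_nonneg fun i _ => mul_nonneg (hw i) (hf i)
  have h1 : (∑ i ∈ s, w i * f i) ^ r ≤ (∑ i ∈ s, w i) ^ (r - 1) * ∑ i ∈ s, w i * f i ^ r := by
    have h := Real.inner_le_weight_mul_Lp_of_nonneg s (p := r) (by exact_mod_cast hr) w f hw hf
    simp only [Real.rpow_natCast] at h
    calc _ ≤ _ := pow_le_pow_left₀ h0 h r
      _ = _ := by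
        rw [mul_pow, ← Real.rpow_natCast, ← Real.rpow_mul hS, ← Real.rpow_natCast _ r,
          ← Real.rpow_mul hT, ← Real.rpow_natCast _ (r - 1), Nat.cast_sub hr, sub_mul,
          inv_mul_cancel₀ hr0]
        simp
  have h2 := Finset.sum_mul_sq_le_sq_mul_sq s w fun i => f i ^ r
  calc (∑ i ∈ s, w i * f i) ^ (2 * r) = ((∑ i ∈ s, w i * f i) ^ r) ^ 2 := by
        rw [← pow_mul, mul_comm]
    _ ≤ ((∑ i ∈ s, w i) ^ (r - 1) * ∑ i ∈ s, w i * f i ^ r) ^ 2 :=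
        pow_le_pow_left₀ (pow_nonneg h0 _) h1 2
    _ = (∑ i ∈ s, w i) ^ (2 * r - 2) * (∑ i ∈ s, w i * f i ^ r) ^ 2 := by
        rw [mul_pow, ← pow_mul]; congr 2; omega
    _ ≤ (∑ i ∈ s, w i) ^ (2 * r - 2) * ((∑ i ∈ s, w i ^ 2) * ∑ i ∈ s, (f i ^ r) ^ 2) := by
        gcongr
    _ = _ := by
        rw [← mul_assoc]
        simp only [← pow_mul, mul_comm r 2]

theorem addChar_map_sum {ι A M : Type*} [AddCommMonoid A] [CommMonoid M] (ψ : AddChar A M)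
    (s : Finset ι) (f : ι → A) : ψ (∑ i ∈ s, f i) = ∏ i ∈ s, ψ (f i) := by
  classical
  induction s using Finset.induction_on with
  | empty => simp
  | insert a s ha ih => rw [Finset.sum_insert ha, Finset.prod_insert ha, AddChar.map_add_eq_mul, ih]

/-- Expand the product over tuples; by orthogonality the sum over t retains only those whose
inverses sum to 0, each with weight q. -/
theorem norm_sum_prod_le {q : ℕ} [NeZero q] {k : ℕ} (D : Finset (ZMod q)ˣ)
    (c : Fin k → (ZMod q)ˣ → ℂ) {B : ℝ} (hc : ∀ i, ∀ y ∈ D, ‖c i y‖ ≤ B) :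
    ‖∑ t : ZMod q, ∏ i, ∑ y ∈ D, c i y * ZMod.stdAddChar (t * ((y⁻¹ : (ZMod q)ˣ) : ZMod q))‖
      ≤ q * B ^ k * (((Fintype.piFinset fun _ : Fin k => D).filter
          fun z => ∑ i, (((z i)⁻¹ : (ZMod q)ˣ) : ZMod q) = 0).card : ℝ) := by
  have h1 : ∀ t : ZMod q,
      ∏ i, ∑ y ∈ D, c i y * ZMod.stdAddChar (t * ((y⁻¹ : (ZMod q)ˣ) : ZMod q))
      = ∑ z ∈ Fintype.piFinset fun _ : Fin k => D, (∏ i, c i (z i)) *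
          ZMod.stdAddChar (t * ∑ i, (((z i)⁻¹ : (ZMod q)ˣ) : ZMod q)) := by
    intro t
    rw [Finset.prod_univ_sum]
    refine Finset.sum_congr rfl fun z _ => ?_
    rw [Finset.prod_mul_distrib, Finset.mul_sum, addChar_map_sum]
  simp only [h1]
  rw [Finset.sum_comm]
  simp only [← Finset.mul_sum, AddChar.sum_mulShift _ (ZMod.isPrimitive_stdAddChar q), ZMod.card]
  simp only [Nat.cast_ite, Nat.cast_zero, mul_ite, mul_zero]
  rw [← Finset.sum_filter]
  refine (norm_sum_le _ _).trans ?_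
  calc _ ≤ ∑ z ∈ (Fintype.piFinset fun _ : Fin k => D).filter
          fun z => ∑ i, (((z i)⁻¹ : (ZMod q)ˣ) : ZMod q) = 0, q * B ^ k := by
        refine Finset.sum_le_sum fun z hz => ?_
        rw [Finset.mem_filter, Fintype.mem_piFinset] at hz
        rw [norm_mul, Complex.norm_natCast, mul_comm, norm_prod]
        refine mul_le_mul_of_nonneg_left ?_ (Nat.cast_nonneg _)
        calc ∏ i, ‖c i (z i)‖ ≤ ∏ _i : Fin k, B :=
              Finset.prod_le_prod (fun _ _ => norm_nonneg _) fun i _ => hc i _ (hz.1 i)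
          _ = B ^ k := by simp
    _ = _ := by rw [Finset.sum_const, nsmul_eq_mul]; ring

theorem isCoprime_valMinAbs_units {q : ℕ} (x : (ZMod q)ˣ) :
    IsCoprime (x : ZMod q).valMinAbs (q : ℤ) := by
  rw [isCoprime_comm, ← ZMod.coe_int_isUnit_iff_isCoprime]
  rw [ZMod.coe_valMinAbs]; exact x.isUnit

/-- Multiplying the sum of inverses by the product of all z_j gives the numerator modulo q. -/
theorem card_inv_sum_eq_zero_le {q : ℕ} [NeZero q] {k X : ℕ} (D : Finset (ZMod q)ˣ)
    (hD : ∀ y ∈ D, (y : ZMod q).valMinAbs ≠ 0 ∧ |(y : ZMod q).valMinAbs| ≤ X) :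
    ((Fintype.piFinset fun _ : Fin k => D).filter
        fun z => ∑ i, (((z i)⁻¹ : (ZMod q)ˣ) : ZMod q) = 0).card
      ≤ (reciprocalSolutions k X q).card := by
  refine Finset.card_le_card_of_injOn (fun z i => (z i : ZMod q).valMinAbs) ?_ ?_
  · intro z hz
    rw [Finset.mem_coe, Finset.mem_filter, Fintype.mem_piFinset] at hz
    rw [Finset.mem_coe, reciprocalSolutions, Finset.mem_filter, mem_nonzeroTuples]
    refine ⟨fun i => hD _ (hz.1 i), fun i => isCoprime_valMinAbs_units _, ?_⟩
    rw [← ZMod.intCast_zmod_eq_zero_iff_dvd, reciprocalNumerator]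
    push_cast
    calc ∑ i, ∏ j ∈ Finset.univ.erase i, (z j : ZMod q)
        = ∑ i, (∏ j, (z j : ZMod q)) * (((z i)⁻¹ : (ZMod q)ˣ) : ZMod q) := by
          refine Finset.sum_congr rfl fun i _ => ?_
          rw [← Finset.mul_prod_erase _ _ (Finset.mem_univ i), mul_comm (z i : ZMod q), mul_assoc,
            Units.mul_inv, mul_one]
      _ = 0 := by rw [← Finset.mul_sum, hz.2, mul_zero]
  · intro z _ z' _ h
    funext i
    exact Units.ext (ZMod.injective_valMinAbs (congrFun h i))

theorem prod_range_even_odd {M : Type*} [CommMonoid M] (a b : M) (r : ℕ) :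
    ∏ i ∈ Finset.range (2 * r), (if Even i then a else b) = (a * b) ^ r := by
  induction r with
  | zero => simp
  | succ r ih =>
    rw [show 2 * (r + 1) = 2 * r + 1 + 1 by ring, Finset.prod_range_succ, Finset.prod_range_succ,
      ih, pow_succ, mul_assoc]
    simp

/-- The `2 r`-th moment of a weighted sum of additive characters at inverses is controlled by the
number of solutions of a congruence with reciprocals. -/
theorem sum_norm_pow_le {q : ℕ} [NeZero q] {r X : ℕ} (D : Finset (ZMod q)ˣ)
    (hD : ∀ y ∈ D, (y : ZMod q).valMinAbs ≠ 0 ∧ |(y : ZMod q).valMinAbs| ≤ X)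
    (hneg : ∀ y ∈ D, -y ∈ D) (b : (ZMod q)ˣ → ℂ) {B : ℝ} (hB : 0 ≤ B) (hb : ∀ y ∈ D, ‖b y‖ ≤ B) :
    ∑ t : ZMod q, ‖∑ y ∈ D, b y * ZMod.stdAddChar (t * ((y⁻¹ : (ZMod q)ˣ) : ZMod q))‖ ^ (2 * r)
      ≤ q * B ^ (2 * r) * ((reciprocalSolutions (2 * r) X q).card : ℝ) := by
  set F : ZMod q → ℂ := fun t =>
    ∑ y ∈ D, b y * ZMod.stdAddChar (t * ((y⁻¹ : (ZMod q)ˣ) : ZMod q)) with hF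
  -- As `D` is symmetric, y ↦ -y writes the conjugate of `F` with the same characters as `F`. Hence
  -- |F|^(2r) is a product of 2r sums of one shape, and the resulting congruence has only plus
  -- signs.
  set c : Fin (2 * r) → (ZMod q)ˣ → ℂ := fun i y =>
    if Even (i : ℕ) then b y else starRingEnd ℂ (b (-y)) with hc
  have hconj : ∀ t, starRingEnd ℂ (F t) = ∑ y ∈ D, starRingEnd ℂ (b (-y)) *
      ZMod.stdAddChar (t * ((y⁻¹ : (ZMod q)ˣ) : ZMod q)) := by
    intro t
    rw [hF, map_sum]
    refine Finset.sum_nbij' (fun y => -y) (fun y => -y) hneg hneg (by simp) (by simp) ?_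
    intro y _
    rw [map_mul, ← AddChar.map_neg_eq_conj, neg_neg, inv_neg, Units.val_neg, mul_neg]
  have hprod : ∀ t, ((‖F t‖ ^ (2 * r) : ℝ) : ℂ) = ∏ i : Fin (2 * r), ∑ y ∈ D, c i y *
      ZMod.stdAddChar (t * ((y⁻¹ : (ZMod q)ˣ) : ZMod q)) := by
    intro t
    have h1 : ∀ i : Fin (2 * r), ∑ y ∈ D, c i y *
        ZMod.stdAddChar (t * ((y⁻¹ : (ZMod q)ˣ) : ZMod q))
        = if Even (i : ℕ) then F t else starRingEnd ℂ (F t) := by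
      intro i
      rw [hconj]
      simp only [hc]
      split_ifs <;> rfl
    simp only [h1]
    rw [← Finset.prod_range (fun i => if Even i then F t else starRingEnd ℂ (F t)),
      prod_range_even_odd, Complex.mul_conj, Complex.normSq_eq_norm_sq]
    push_cast
    rw [pow_mul]
  have hcb : ∀ i, ∀ y ∈ D, ‖c i y‖ ≤ B := by
    intro i y hy
    simp only [hc]
    split_ifs
    · exact hb y hy
    · rw [RCLike.norm_conj]; exact hb _ (hneg y hy)
  have hnn : 0 ≤ ∑ t : ZMod q, ‖F t‖ ^ (2 * r) :=
    Finset.sum_nonneg fun _ _ => pow_nonneg (norm_nonneg _) _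
  calc ∑ t : ZMod q, ‖F t‖ ^ (2 * r) = ‖((∑ t : ZMod q, ‖F t‖ ^ (2 * r) : ℝ) : ℂ)‖ := by
        rw [Complex.norm_real, Real.norm_of_nonneg hnn]
    _ = ‖∑ t : ZMod q, ∏ i : Fin (2 * r), ∑ y ∈ D, c i y *
          ZMod.stdAddChar (t * ((y⁻¹ : (ZMod q)ˣ) : ZMod q))‖ := by
        rw [Complex.ofReal_sum]; simp only [hprod]
    _ ≤ _ := norm_sum_prod_le D c hcb
    _ ≤ _ := by
        gcongr
        exact card_inv_sum_eq_zero_le D hD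

/-! ### Fibre counts and dyadic blocks of units. -/

theorem sum_card_fiber_sq {ι κ : Type*} [Fintype κ] [DecidableEq κ] (P : Finset ι) (φ : ι → κ) :
    ∑ t, (P.filter fun p => φ p = t).card ^ 2
      = ((P ×ˢ P).filter fun p => φ p.1 = φ p.2).card := by
  classical
  rw [Finset.card_eq_sum_card_fiberwise (f := fun p : ι × ι => φ p.1) (t := Finset.univ)
    (fun _ _ => Finset.mem_coe.mpr (Finset.mem_univ _))]
  refine Finset.sum_congr rfl fun t _ => ?_
  rw [sq, ← Finset.card_product]
  congr 1
  ext p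
  simp only [Finset.mem_product, Finset.mem_filter]
  constructor
  · rintro ⟨⟨h1, h2⟩, h3, h4⟩; exact ⟨⟨⟨h1, h3⟩, h2.trans h4.symm⟩, h2⟩
  · rintro ⟨⟨⟨h1, h3⟩, h4⟩, h2⟩; exact ⟨⟨h1, h2⟩, h3, h4.symm.trans h2⟩

/-- The units modulo `q` whose least absolute residue lies in `[2 ^ i, 2 ^ (i + 1))`. -/
noncomputable def dyadicUnits (q : ℕ) [NeZero q] (i : ℕ) : Finset (ZMod q)ˣ :=
  Finset.univ.filter fun x => Nat.log 2 (x : ZMod q).valMinAbs.natAbs = i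

theorem valMinAbs_unit_ne_zero {q : ℕ} (hq : 1 < q) (x : (ZMod q)ˣ) :
    (x : ZMod q).valMinAbs ≠ 0 := by
  have : Fact (1 < q) := ⟨hq⟩
  rw [Ne, ZMod.valMinAbs_eq_zero]
  exact x.ne_zero

theorem pow_le_natAbs_of_mem_dyadicUnits {q : ℕ} [NeZero q] (hq : 1 < q) {i : ℕ} {x : (ZMod q)ˣ}
    (hx : x ∈ dyadicUnits q i) : 2 ^ i ≤ (x : ZMod q).valMinAbs.natAbs := by
  rw [dyadicUnits, Finset.mem_filter] at hx
  rw [← hx.2]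
  exact Nat.pow_log_le_self 2 (Int.natAbs_ne_zero.mpr (valMinAbs_unit_ne_zero hq x))

theorem abs_valMinAbs_le_of_mem_dyadicUnits {q : ℕ} [NeZero q] {i : ℕ} {x : (ZMod q)ˣ}
    (hx : x ∈ dyadicUnits q i) : |(x : ZMod q).valMinAbs| ≤ (2 ^ (i + 1) : ℕ) := by
  rw [dyadicUnits, Finset.mem_filter] at hx
  have := Nat.lt_pow_succ_log_self (b := 2) (by norm_num) (x : ZMod q).valMinAbs.natAbs
  rw [hx.2] at this
  rw [Int.abs_eq_natAbs]
  exact_mod_cast this.le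

/-- A least absolute residue is at most q/2. Nonempty blocks thus stay in the range X ≤ q of the
counting bounds. -/
theorem two_pow_succ_le_of_mem_dyadicUnits {q : ℕ} [NeZero q] (hq : 1 < q) {i : ℕ}
    {x : (ZMod q)ˣ} (hx : x ∈ dyadicUnits q i) : 2 ^ (i + 1) ≤ q := by
  have h1 := pow_le_natAbs_of_mem_dyadicUnits hq hx
  have h2 := ZMod.natAbs_valMinAbs_le (x : ZMod q)
  rw [pow_succ]
  omega

theorem neg_mem_dyadicUnits {q : ℕ} [NeZero q] {i : ℕ} {x : (ZMod q)ˣ}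
    (hx : x ∈ dyadicUnits q i) : -x ∈ dyadicUnits q i := by
  rw [dyadicUnits, Finset.mem_filter] at hx ⊢
  refine ⟨Finset.mem_univ _, ?_⟩
  rw [Units.val_neg, ZMod.natAbs_valMinAbs_neg]
  exact hx.2

theorem sum_dyadicUnits {E : Type*} [AddCommMonoid E] {q : ℕ} [NeZero q] (f : (ZMod q)ˣ → E) :
    ∑ i ∈ Finset.range (Nat.log 2 q + 1), ∑ x ∈ dyadicUnits q i, f x = ∑ x, f x := by
  refine Finset.sum_fiberwise_of_maps_to (fun x _ => ?_) f
  rw [Finset.mem_range, Nat.lt_succ_iff]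
  refine Nat.log_mono_right ?_
  have := ZMod.natAbs_valMinAbs_le (x : ZMod q)
  omega

theorem norm_sum_consecutive_le_min {q : ℕ} [NeZero q] (hq : 1 < q) (v : ℤ) (M : ℕ) {i : ℕ}
    {x : (ZMod q)ˣ} (hx : x ∈ dyadicUnits q i) :
    ‖∑ m ∈ consecutive v M, ZMod.stdAddChar ((m : ZMod q) * (x : ZMod q))‖ ≤ min (M : ℝ) (q / 2 ^ i) := by
  refine le_min (norm_sum_consecutive_le_card v M _) ?_
  have : Fact (1 < q) := ⟨hq⟩
  refine (norm_sum_consecutive_le_div v M x.ne_zero).trans ?_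
  have h := pow_le_natAbs_of_mem_dyadicUnits hq hx
  have h' : (2 : ℝ) ^ i ≤ ((x : ZMod q).valMinAbs.natAbs : ℝ) := by exact_mod_cast h
  gcongr

theorem card_dyadicUnits_le {q : ℕ} [NeZero q] (i : ℕ) :
    ((dyadicUnits q i).card : ℝ) ≤ 6 * 2 ^ i := by
  have h := card_le_of_abs_le (X := 2 ^ (i + 1)) Nat.one_le_two_pow
    (D := (dyadicUnits q i).image fun x : (ZMod q)ˣ => (x : ZMod q).valMinAbs) (by
      intro y hy
      obtain ⟨x, hx, rfl⟩ := Finset.mem_image.mp hy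
      exact abs_valMinAbs_le_of_mem_dyadicUnits hx)
  rw [Finset.card_image_of_injective _
    (fun x y h => Units.ext (ZMod.injective_valMinAbs h))] at h
  push_cast [pow_succ] at h
  linarith

/-! ### Hölder's inequality over the ratios ℓ/x. -/

/-- Hölder's inequality together with the count of `ratioCongruences` bounds the sum of `F` over
the ratios `ℓ / x` by the `2 r`-th moment of `F`. -/
theorem exists_sum_ratio_pow_le {r : ℕ} (hr : 1 ≤ r) {δ : ℝ} (hδ : 0 < δ) :
    ∃ C : ℝ, 1 ≤ C ∧ ∀ (q : ℕ) [NeZero q], 1 < q → ∀ i : ℕ, (dyadicUnits q i).Nonempty →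
      ∀ (u : ℤ) (L : ℕ) (I : Finset ℤ), I ⊆ consecutive u L →
      (∀ l ∈ I, IsCoprime l (q : ℤ)) → ∀ F : ZMod q → ℝ, (∀ t, 0 ≤ F t) →
      ∀ a M : ℝ, 0 ≤ a → a ≤ M → a * 2 ^ i ≤ q →
        (a * ∑ l ∈ I, ∑ x ∈ dyadicUnits q i, F ((l : ZMod q) * ((x⁻¹ : (ZMod q)ˣ) : ZMod q)))
            ^ (2 * r)
          ≤ C * (q : ℝ) ^ δ * ((L : ℝ) ^ (2 * r - 1) * (L + M)) * (q : ℝ) ^ (2 * r - 1)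
            * ∑ t, F t ^ (2 * r) := by
  obtain ⟨C, hC1, hC⟩ := exists_card_ratioCongruences_le hδ
  refine ⟨6 ^ (2 * r - 2) * (4 * C), ?_, ?_⟩
  · have : (1 : ℝ) ≤ 6 ^ (2 * r - 2) := one_le_pow₀ (by norm_num)
    nlinarith
  intro q _ hq i hne u L I hI hIq F hF a M ha haM haq
  have hq0 : (0 : ℝ) < q := by exact_mod_cast NeZero.pos q
  set D := dyadicUnits q i with hD
  set φ : ℤ × (ZMod q)ˣ → ZMod q := fun p => (p.1 : ZMod q) * ((p.2⁻¹ : (ZMod q)ˣ) : ZMod q)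
    with hφ
  set ν : ZMod q → ℝ := fun t => (((I ×ˢ D).filter fun p => φ p = t).card : ℝ) with hν
  have hν0 : ∀ t, 0 ≤ ν t := fun t => Nat.cast_nonneg _
  have hsum : ∑ l ∈ I, ∑ x ∈ D, F ((l : ZMod q) * ((x⁻¹ : (ZMod q)ˣ) : ZMod q))
      = ∑ t, ν t * F t := by
    rw [← Finset.sum_product', ← Finset.sum_fiberwise (I ×ˢ D) φ]
    refine Finset.sum_congr rfl fun t _ => ?_
    rw [hν, ← nsmul_eq_mul, ← Finset.sum_const]
    refine Finset.sum_congr rfl fun p hp => ?_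
    rw [← (Finset.mem_filter.mp hp).2]
  have hIcard : (I.card : ℝ) ≤ L := by
    exact_mod_cast (Finset.card_le_card hI).trans_eq (card_consecutive u L)
  have hν1 : ∑ t, ν t ≤ L * (6 * 2 ^ i) := by
    have : ∑ t, ν t = ((I ×ˢ D).card : ℝ) := by
      simp only [hν]
      exact_mod_cast (Finset.card_eq_sum_card_fiberwise (f := φ) (t := Finset.univ)
        (fun _ _ => Finset.mem_coe.mpr (Finset.mem_univ _))).symm
    rw [this, Finset.card_product]
    push_cast
    gcongr
    exact card_dyadicUnits_le i
  set D' : Finset ℤ := D.image fun x : (ZMod q)ˣ => (x : ZMod q).valMinAbs with hD'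
  have hν2 : ∑ t, ν t ^ 2 ≤ ((ratioCongruences q I D').card : ℝ) := by
    have h1 : ∑ t, ν t ^ 2
        = ((((I ×ˢ D) ×ˢ (I ×ˢ D)).filter fun p => φ p.1 = φ p.2).card : ℝ) := by
      simp only [hν]
      exact_mod_cast sum_card_fiber_sq (I ×ˢ D) φ
    have h2 : (((I ×ˢ D) ×ˢ (I ×ˢ D)).filter fun p => φ p.1 = φ p.2).card
        ≤ (ratioCongruences q I D').card := by
      refine Finset.card_le_card_of_injOn (fun p => ((p.1.1, p.2.1),
        (p.1.2 : ZMod q).valMinAbs, (p.2.2 : ZMod q).valMinAbs)) ?_ ?_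
      · rintro ⟨⟨l, x⟩, l', x'⟩ h
        simp only [Finset.mem_coe, Finset.mem_filter, Finset.mem_product, hφ] at h
        rw [Finset.mem_coe, mem_ratioCongruences]
        refine ⟨⟨h.1.1.1, h.1.2.1⟩, ⟨Finset.mem_image_of_mem _ h.1.1.2,
          Finset.mem_image_of_mem _ h.1.2.2⟩, ?_⟩
        rw [← ZMod.intCast_zmod_eq_zero_iff_dvd]
        push_cast
        rw [sub_eq_zero]
        -- Multiplying ℓ/x = ℓ'/x' by xx' clears the inverses.
        have h3 := congrArg (fun z => z * (x : ZMod q) * x') h.2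
        simp only [mul_assoc] at h3
        rw [← mul_assoc _ (x : ZMod q) (x' : ZMod q), Units.inv_mul, one_mul,
          mul_comm (x : ZMod q) x', ← mul_assoc _ (x' : ZMod q) (x : ZMod q), Units.inv_mul,
          one_mul] at h3
        exact h3
      · rintro ⟨⟨l, x⟩, l', x'⟩ - ⟨⟨m, y⟩, m', y'⟩ - h
        simp only [Prod.mk.injEq] at h
        obtain ⟨⟨rfl, rfl⟩, hx, hy⟩ := h
        rw [Units.ext (ZMod.injective_valMinAbs hx), Units.ext (ZMod.injective_valMinAbs hy)]
    rw [h1]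
    exact_mod_cast h2
  have hcount : ((ratioCongruences q I D').card : ℝ) ≤ C * (q : ℝ) ^ δ *
      (L * (2 * 2 ^ i) + (L : ℝ) ^ 2 * (2 * 2 ^ i) ^ 2 / q) := by
    obtain ⟨x₀, hx₀⟩ := hne
    have h := hC q hq.le (2 ^ (i + 1)) Nat.one_le_two_pow
      (two_pow_succ_le_of_mem_dyadicUnits hq hx₀) D' (by
        intro y hy
        obtain ⟨x, hx, rfl⟩ := Finset.mem_image.mp hy
        exact ⟨valMinAbs_unit_ne_zero hq x, abs_valMinAbs_le_of_mem_dyadicUnits hx,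
          isCoprime_valMinAbs_units x⟩) (by
        intro y hy y' hy' hd
        obtain ⟨x, hx, rfl⟩ := Finset.mem_image.mp hy
        obtain ⟨x', hx', rfl⟩ := Finset.mem_image.mp hy'
        rw [← ZMod.intCast_zmod_eq_zero_iff_dvd] at hd
        push_cast at hd
        rw [sub_eq_zero] at hd
        rw [hd]) u L I hI hIq
    push_cast [pow_succ] at h
    rwa [mul_comm _ (2 : ℝ)] at h
  -- The bound `a` for the geometric sum cancels the block length 2^i up to a factor q.
  have hpart1 : a * ∑ t, ν t ≤ 6 * (L * q) := by
    calc a * ∑ t, ν t ≤ a * (L * (6 * 2 ^ i)) := by gcongr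
      _ = 6 * (L * (a * 2 ^ i)) := by ring
      _ ≤ _ := by gcongr
  -- The term LX of the count cancels only one factor `a`; the other is bounded by `M`, which
  -- produces L(L + M).
  have hpart2 : a ^ 2 * ∑ t, ν t ^ 2 ≤ 4 * C * (q : ℝ) ^ δ * (L * (L + M)) * q := by
    calc a ^ 2 * ∑ t, ν t ^ 2 ≤ a ^ 2 * (C * (q : ℝ) ^ δ *
          (L * (2 * 2 ^ i) + (L : ℝ) ^ 2 * (2 * 2 ^ i) ^ 2 / q)) := by
          gcongr; exact hν2.trans hcount
      _ = C * (q : ℝ) ^ δ * (2 * L * a * (a * 2 ^ i) + 4 * (L : ℝ) ^ 2 * (a * 2 ^ i) ^ 2 / q) := by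
          ring
      _ ≤ C * (q : ℝ) ^ δ * (2 * L * M * q + 4 * (L : ℝ) ^ 2 * (q : ℝ) ^ 2 / q) := by
          have : 0 ≤ M := ha.trans haM
          gcongr
      _ = C * (q : ℝ) ^ δ * (2 * L * M * q + 4 * (L : ℝ) ^ 2 * q) := by
          congr 2; field_simp
      _ ≤ C * (q : ℝ) ^ δ * (4 * L * M * q + 4 * (L : ℝ) ^ 2 * q) := by
          have : 0 ≤ M := ha.trans haM
          gcongr; norm_num
      _ = _ := by ring
  have hH := sum_mul_pow_two_mul_le Finset.univ hr ν F hν0 hF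
  have hnn : 0 ≤ ∑ t, ν t := Finset.sum_nonneg fun t _ => hν0 t
  have hFnn : 0 ≤ ∑ t, F t ^ (2 * r) := Finset.sum_nonneg fun t _ => pow_nonneg (hF t) _
  have hM : 0 ≤ M := ha.trans haM
  have hexp : ∀ z : ℝ, z ^ (2 * r) = z ^ (2 * r - 2) * z ^ 2 := fun z => by
    rw [← pow_add]; congr 1; omega
  have hexp1 : ∀ z : ℝ, z ^ (2 * r - 1) = z ^ (2 * r - 2) * z := fun z => by
    rw [← pow_succ]; congr 1; omega
  rw [hsum]
  calc (a * ∑ t, ν t * F t) ^ (2 * r)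
      ≤ a ^ (2 * r) * ((∑ t, ν t) ^ (2 * r - 2) * (∑ t, ν t ^ 2) * ∑ t, F t ^ (2 * r)) := by
        rw [mul_pow]; gcongr
    _ = (a * ∑ t, ν t) ^ (2 * r - 2) * (a ^ 2 * ∑ t, ν t ^ 2) * ∑ t, F t ^ (2 * r) := by
        rw [hexp a, mul_pow]; ring
    _ ≤ (6 * (L * q)) ^ (2 * r - 2) * (4 * C * (q : ℝ) ^ δ * (L * (L + M)) * q)
          * ∑ t, F t ^ (2 * r) := by
        refine mul_le_mul_of_nonneg_right (mul_le_mul ?_ hpart2 ?_ ?_) hFnn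
        · exact pow_le_pow_left₀ (mul_nonneg ha hnn) hpart1 _
        · exact mul_nonneg (sq_nonneg _) (Finset.sum_nonneg fun t _ => sq_nonneg _)
        · positivity
    _ = _ := by
        rw [hexp1 (L : ℝ), hexp1 (q : ℝ), mul_pow, mul_pow]
        generalize (∑ t, F t ^ (2 * r)) = G
        generalize 2 * r - 2 = k
        ring

/-! ### Assembly of the estimate. -/

/-- The numerical form of the moment bound on a dyadic block, given a bound for the number of
solutions of the reciprocal congruence. -/
theorem mul_pow_mul_le_of_le {r : ℕ} (hr : 1 ≤ r) {q Q b N Y J T : ℝ} (hQ : 0 < Q) (hq : 0 < q)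
    (hqQ : q ≤ 2 * Q) (hb : 0 ≤ b) (hbN : b ≤ N) (hY : 0 ≤ Y) (hbY : b * Y ≤ 2 * q) (hT : 0 ≤ T)
    (hJ : J ≤ (Y ^ r + Y ^ (2 * r) / Q) * T) :
    q * b ^ (2 * r) * J ≤ 2 * 4 ^ r * q * (N ^ r * q ^ r + q ^ (2 * r - 1)) * T := by
  have hN : 0 ≤ N := hb.trans hbN
  have hQq : 1 / Q ≤ 2 / q := by rw [div_le_div_iff₀ hQ hq]; linarith
  -- Here r of the 2r factors `b` absorb Y^r through bY ≤ 2q and the others are bounded by `N`; in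
  -- `h2` all 2r of them absorb Y^(2r).
  have h1 : b ^ (2 * r) * Y ^ r ≤ 4 ^ r * (N ^ r * q ^ r) := by
    calc b ^ (2 * r) * Y ^ r = b ^ r * (b * Y) ^ r := by rw [mul_pow]; ring
      _ ≤ N ^ r * (4 * q) ^ r := by
        refine mul_le_mul (pow_le_pow_left₀ hb hbN r)
          (pow_le_pow_left₀ (by positivity) (by linarith) r) (by positivity) (by positivity)
      _ = _ := by rw [mul_pow]; ring
  have h2 : b ^ (2 * r) * (Y ^ (2 * r) / Q) ≤ 2 * 4 ^ r * q ^ (2 * r - 1) := by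
    calc b ^ (2 * r) * (Y ^ (2 * r) / Q) = (b * Y) ^ (2 * r) * (1 / Q) := by rw [mul_pow]; ring
      _ ≤ (2 * q) ^ (2 * r) * (2 / q) := by gcongr
      _ = 2 * 4 ^ r * q ^ (2 * r - 1) := by
        have : q ^ (2 * r) = q ^ (2 * r - 1) * q := by rw [← pow_succ]; congr 1; omega
        rw [mul_pow, this, pow_mul]; field_simp; norm_num
  calc q * b ^ (2 * r) * J ≤ q * b ^ (2 * r) * ((Y ^ r + Y ^ (2 * r) / Q) * T) := by gcongr
    _ = q * T * (b ^ (2 * r) * Y ^ r + b ^ (2 * r) * (Y ^ (2 * r) / Q)) := by ring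
    _ ≤ q * T * (2 * 4 ^ r * (N ^ r * q ^ r) + 2 * 4 ^ r * q ^ (2 * r - 1)) := by
        refine mul_le_mul_of_nonneg_left (add_le_add (h1.trans ?_) h2) (by positivity)
        have : (0 : ℝ) ≤ 4 ^ r * (N ^ r * q ^ r) := by positivity
        linarith
    _ = _ := by ring

/-- The substitutions x ↦ x⁻¹ and y ↦ y⁻¹ move the inverses onto the factor containing ℓ, so the
sums over m and n become geometric. -/
theorem sum_sum_doubleKloosterman {q : ℕ} [NeZero q] (l : ℤ) (S T : Finset ℤ) :
    ∑ m ∈ S, ∑ n ∈ T, doubleKloosterman q l m n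
      = ∑ x : (ZMod q)ˣ, (∑ m ∈ S, ZMod.stdAddChar ((m : ZMod q) * (x : ZMod q))) *
          ∑ y : (ZMod q)ˣ, (∑ n ∈ T, ZMod.stdAddChar ((n : ZMod q) * (y : ZMod q))) *
            ZMod.stdAddChar ((l : ZMod q) * ((x⁻¹ : (ZMod q)ˣ) : ZMod q)
              * ((y⁻¹ : (ZMod q)ˣ) : ZMod q)) := by
  have h : ∀ m n : ℤ, doubleKloosterman q l m n = ∑ x : (ZMod q)ˣ, ∑ y : (ZMod q)ˣ,
      ZMod.stdAddChar ((m : ZMod q) * (x : ZMod q)) *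
        (ZMod.stdAddChar ((n : ZMod q) * (y : ZMod q)) *
          ZMod.stdAddChar ((l : ZMod q) * ((x⁻¹ : (ZMod q)ˣ) : ZMod q)
            * ((y⁻¹ : (ZMod q)ˣ) : ZMod q))) := by
    intro m n
    rw [doubleKloosterman, ← Equiv.sum_comp (Equiv.inv (ZMod q)ˣ)]
    refine Finset.sum_congr rfl fun x _ => ?_
    rw [← Equiv.sum_comp (Equiv.inv (ZMod q)ˣ)]
    refine Finset.sum_congr rfl fun y _ => ?_
    simp only [Equiv.inv_apply, inv_inv]
    rw [AddChar.map_add_eq_mul, AddChar.map_add_eq_mul]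
    ring
  simp only [h]
  have h1 : ∀ m ∈ S, ∑ n ∈ T, ∑ x : (ZMod q)ˣ, ∑ y : (ZMod q)ˣ,
      ZMod.stdAddChar ((m : ZMod q) * (x : ZMod q)) *
        (ZMod.stdAddChar ((n : ZMod q) * (y : ZMod q)) *
          ZMod.stdAddChar ((l : ZMod q) * ((x⁻¹ : (ZMod q)ˣ) : ZMod q)
            * ((y⁻¹ : (ZMod q)ˣ) : ZMod q)))
      = ∑ x : (ZMod q)ˣ, ZMod.stdAddChar ((m : ZMod q) * (x : ZMod q)) *
          ∑ y : (ZMod q)ˣ, (∑ n ∈ T, ZMod.stdAddChar ((n : ZMod q) * (y : ZMod q))) *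
            ZMod.stdAddChar ((l : ZMod q) * ((x⁻¹ : (ZMod q)ˣ) : ZMod q)
              * ((y⁻¹ : (ZMod q)ˣ) : ZMod q)) := by
    intro m _
    rw [Finset.sum_comm]
    refine Finset.sum_congr rfl fun x _ => ?_
    rw [Finset.sum_comm, Finset.mul_sum]
    refine Finset.sum_congr rfl fun y _ => ?_
    rw [Finset.sum_mul, Finset.mul_sum]
  rw [Finset.sum_congr rfl h1, Finset.sum_comm]
  refine Finset.sum_congr rfl fun x _ => ?_
  rw [Finset.sum_mul]

/-- The dyadic block of the completed sum over `y`. -/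
noncomputable def dyadicReciprocalSum (q : ℕ) [NeZero q] (w : ℤ) (N j : ℕ) (t : ZMod q) : ℂ :=
  ∑ y ∈ dyadicUnits q j, (∑ n ∈ consecutive w N, ZMod.stdAddChar ((n : ZMod q) * (y : ZMod q))) *
    ZMod.stdAddChar (t * ((y⁻¹ : (ZMod q)ˣ) : ZMod q))

/-- The geometric sum over m is bounded in absolute value at once, which allows the weights to be
dropped; the one over n stays inside as a coefficient, to be used in the moment. -/
theorem norm_trilinearKloosterman_le {q : ℕ} [NeZero q] (hq : 1 < q) (α : ℤ → ℂ) (u v w : ℤ)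
    (L M N : ℕ) (hα : ∀ l ∈ consecutive u L, ‖α l‖ ≤ 1)
    (hα0 : ∀ l ∈ consecutive u L, ¬ IsCoprime l (q : ℤ) → α l = 0) :
    ‖trilinearKloosterman q α u v w L M N‖
      ≤ ∑ i ∈ Finset.range (Nat.log 2 q + 1), ∑ j ∈ Finset.range (Nat.log 2 q + 1),
          min (M : ℝ) (q / 2 ^ i) *
            ∑ l ∈ (consecutive u L).filter fun l => IsCoprime l (q : ℤ),
              ∑ x ∈ dyadicUnits q i, ‖dyadicReciprocalSum q w N j
                ((l : ZMod q) * ((x⁻¹ : (ZMod q)ˣ) : ZMod q))‖ := by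
  set I := (consecutive u L).filter fun l => IsCoprime l (q : ℤ) with hI
  set K := Finset.range (Nat.log 2 q + 1) with hK
  have h1 : trilinearKloosterman q α u v w L M N = ∑ l ∈ I, α l *
      ∑ m ∈ consecutive v M, ∑ n ∈ consecutive w N, doubleKloosterman q l m n := by
    rw [trilinearKloosterman, hI, Finset.sum_filter_of_ne]
    intro l hl hne
    by_contra hcop
    rw [hα0 l hl hcop, zero_mul] at hne
    exact hne rfl
  have h2 : ∀ l ∈ I, ‖α l * ∑ m ∈ consecutive v M, ∑ n ∈ consecutive w N,
      doubleKloosterman q l m n‖ ≤ ∑ i ∈ K, ∑ x ∈ dyadicUnits q i, ∑ j ∈ K,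
        min (M : ℝ) (q / 2 ^ i) * ‖dyadicReciprocalSum q w N j
          ((l : ZMod q) * ((x⁻¹ : (ZMod q)ˣ) : ZMod q))‖ := by
    intro l hl
    rw [norm_mul, sum_sum_doubleKloosterman]
    refine (mul_le_of_le_one_left (norm_nonneg _) (hα l (Finset.mem_filter.mp hl).1)).trans ?_
    rw [← sum_dyadicUnits]
    refine (norm_sum_le _ _).trans (Finset.sum_le_sum fun i _ => ?_)
    refine (norm_sum_le _ _).trans (Finset.sum_le_sum fun x hx => ?_)
    rw [norm_mul, ← sum_dyadicUnits, ← Finset.mul_sum]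
    refine mul_le_mul (norm_sum_consecutive_le_min hq v M hx) ?_ (norm_nonneg _)
      (le_min (Nat.cast_nonneg _) (by positivity))
    exact norm_sum_le _ _
  rw [h1]
  calc _ ≤ ∑ l ∈ I, ∑ i ∈ K, ∑ x ∈ dyadicUnits q i, ∑ j ∈ K,
        min (M : ℝ) (q / 2 ^ i) * ‖dyadicReciprocalSum q w N j
          ((l : ZMod q) * ((x⁻¹ : (ZMod q)ˣ) : ZMod q))‖ :=
        (norm_sum_le _ _).trans (Finset.sum_le_sum h2)
    _ = _ := by
        rw [Finset.sum_comm]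
        refine Finset.sum_congr rfl fun i _ => ?_
        simp only [Finset.mul_sum]
        calc _ = ∑ l ∈ I, ∑ j ∈ K, ∑ x ∈ dyadicUnits q i, min (M : ℝ) (q / 2 ^ i) *
              ‖dyadicReciprocalSum q w N j ((l : ZMod q) * ((x⁻¹ : (ZMod q)ˣ) : ZMod q))‖ :=
              Finset.sum_congr rfl fun l _ => Finset.sum_comm
          _ = _ := Finset.sum_comm

/-- Take 2r-th roots using a^n + b^n ≤ (a + b)^n for each of the two sums; as C ≥ 1, the constant
need not be reduced to its root. -/
theorem le_of_pow_le_mul {r : ℕ} (hr : 1 ≤ r) {C L M N q κ S : ℝ} (hC : 1 ≤ C) (hL : 0 ≤ L)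
    (hM : 0 ≤ M) (hN : 0 ≤ N) (hq : 0 < q)
    (h : S ^ (2 * r) ≤ C * (L ^ (2 * r - 1) * (L + M)) *
      (q ^ (4 * r - 1) + N ^ r * q ^ (3 * r)) * q ^ (2 * r * κ)) :
    S ≤ C * ((L + L ^ (1 - 1 / (2 * (r : ℝ))) * M ^ (1 / (2 * (r : ℝ)))) *
      (q ^ (2 - 1 / (2 * (r : ℝ))) + N ^ (1 / 2 : ℝ) * q ^ (3 / 2 : ℝ)) * q ^ κ) := by
  have hr0 : (0 : ℝ) < r := by exact_mod_cast hr
  have hn : 2 * r ≠ 0 := by omega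
  have root : ∀ {x a : ℝ}, 0 ≤ x → (x ^ a) ^ (2 * r) = x ^ (a * (2 * r)) := by
    intro x a hx
    rw [← Real.rpow_natCast, ← Real.rpow_mul hx]; push_cast; rfl
  set U := L ^ (1 - 1 / (2 * (r : ℝ))) * M ^ (1 / (2 * (r : ℝ))) with hU
  have hU0 : 0 ≤ U := by positivity
  have hUp : U ^ (2 * r) = L ^ (2 * r - 1) * M := by
    rw [hU, mul_pow, root hL, root hM, sub_mul, div_mul_cancel₀ _ (by positivity), Real.rpow_one,
      one_mul, ← Real.rpow_natCast L (2 * r - 1), Nat.cast_sub (by omega)]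
    push_cast; rfl
  set V := q ^ (2 - 1 / (2 * (r : ℝ))) with hV
  have hVp : V ^ (2 * r) = q ^ (4 * r - 1) := by
    rw [hV, root hq.le, sub_mul, div_mul_cancel₀ _ (by positivity),
      ← Real.rpow_natCast q (4 * r - 1), Nat.cast_sub (by omega)]
    push_cast; congr 1; ring
  set W := N ^ (1 / 2 : ℝ) * q ^ (3 / 2 : ℝ) with hW
  have hWp : W ^ (2 * r) = N ^ r * q ^ (3 * r) := by
    rw [hW, mul_pow, root hN, root hq.le, ← Real.rpow_natCast N r,
      ← Real.rpow_natCast q (3 * r)]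
    push_cast; congr 2 <;> ring
  have hκ : (q ^ κ) ^ (2 * r) = q ^ (2 * r * κ) := by rw [root hq.le]; congr 1; ring
  have hLp : L ^ (2 * r - 1) * (L + M) = L ^ (2 * r) + U ^ (2 * r) := by
    rw [hUp, mul_add, ← pow_succ]; congr 2; omega
  have hV0 : 0 ≤ V := by positivity
  have hW0 : 0 ≤ W := by positivity
  refine le_of_pow_le_pow_left₀ hn (by positivity) (h.trans ?_)
  rw [mul_pow, mul_pow, mul_pow, hκ, hLp, ← hVp, ← hWp, ← mul_assoc, ← mul_assoc]
  have h1 := pow_add_pow_le hL hU0 hn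
  have h2 := pow_add_pow_le hV0 hW0 hn
  have h3 := le_self_pow₀ hC hn
  gcongr

theorem theorem1p2 (ε : ℝ) (hε : 0 < ε) (r : ℕ) (hr : 2 ≤ r) :
    -- `η` plays the role of both terms `o(1)`
    ∀ η : ℝ, 0 < η → ∃ Q₀ : ℝ, ∀ Q : ℝ, Q₀ ≤ Q →
      ∃ E : Finset ℕ, (E.card : ℝ) ≤ Q ^ (1 - 2 * (r : ℝ) * ε + η) ∧
        ∀ (q : ℕ) [NeZero q], Q ≤ (q : ℝ) → (q : ℝ) ≤ 2 * Q → q ∉ E →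
          ∀ (u v w : ℤ) (L M N : ℕ) (α : ℤ → ℂ),
            (∀ l ∈ consecutive u L, ‖α l‖ ≤ 1) →
            (∀ l ∈ consecutive u L, ¬ IsCoprime l (q : ℤ) → α l = 0) →
            ‖trilinearKloosterman q α u v w L M N‖ ≤
              ((L : ℝ) + (L : ℝ) ^ (1 - 1 / (2 * (r : ℝ))) * (M : ℝ) ^ (1 / (2 * (r : ℝ)))) *
                ((q : ℝ) ^ (2 - 1 / (2 * (r : ℝ))) + (N : ℝ) ^ (1 / 2 : ℝ) * (q : ℝ) ^ (3 / 2 : ℝ)) *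
                (q : ℝ) ^ (ε + η) := by
  intro η hη
  have hr1 : 1 ≤ r := by omega
  have hr0 : (0 : ℝ) < r := by exact_mod_cast hr1
  -- After the 2r-th root q^δ becomes q^(η/4). Two further η/4 pay for the pairs of dyadic scales
  -- and the last for the constants.
  obtain ⟨δ, hδ⟩ : ∃ δ : ℝ, δ = 2 * r * (η / 4) := ⟨_, rfl⟩
  have hδ0 : 0 < δ := by rw [hδ]; positivity
  obtain ⟨C₁, hC₁1, hC₁⟩ := exists_sum_ratio_pow_le hr1 hδ0
  obtain ⟨C₂, hC₂1, hC₂⟩ := exists_log_two_add_one_le_rpow (show 0 < η / 4 by positivity)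
  obtain ⟨Q₁, hQ₁⟩ := exists_exceptional_moduli ε r hη
  set C₃ : ℝ := C₁ * (2 * 4 ^ r) with hC₃
  have hC₃1 : 1 ≤ C₃ := by
    have : (1 : ℝ) ≤ 4 ^ r := one_le_pow₀ (by norm_num)
    exact one_le_mul_of_one_le_of_one_le hC₁1 (by linarith)
  obtain ⟨Q₂, hQ₂⟩ := Filter.eventually_atTop.mp
    ((tendsto_rpow_atTop (show 0 < η / 4 by positivity)).eventually_ge_atTop (C₂ ^ 2 * C₃))
  refine ⟨max 2 (max Q₁ Q₂), fun Q hQ => ?_⟩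
  have hQ2 : 2 ≤ Q := (le_max_left _ _).trans hQ
  have hQ0 : 0 < Q := by linarith
  obtain ⟨E, hEcard, hE⟩ := hQ₁ Q ((le_max_left _ _).trans ((le_max_right _ _).trans hQ))
  refine ⟨E, hEcard, ?_⟩
  intro q _ hQq hqQ hqE u v w L M N α hα hα0
  have hq1' : (1 : ℝ) < q := by linarith
  have hq1 : 1 < q := by exact_mod_cast hq1'
  have hq0 : (0 : ℝ) < q := by linarith
  have hqlarge := hQ₂ q (((le_max_right _ _).trans ((le_max_right _ _).trans hQ)).trans hQq)
  set I := (consecutive u L).filter fun l => IsCoprime l (q : ℤ) with hI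
  set R : ℝ := ((L : ℝ) + (L : ℝ) ^ (1 - 1 / (2 * (r : ℝ))) * (M : ℝ) ^ (1 / (2 * (r : ℝ)))) *
    ((q : ℝ) ^ (2 - 1 / (2 * (r : ℝ))) + (N : ℝ) ^ (1 / 2 : ℝ) * (q : ℝ) ^ (3 / 2 : ℝ)) with hR
  have hR0 : 0 ≤ R := by positivity
  have hblock : ∀ i j : ℕ, min (M : ℝ) (q / 2 ^ i) * ∑ l ∈ I, ∑ x ∈ dyadicUnits q i,
      ‖dyadicReciprocalSum q w N j ((l : ZMod q) * ((x⁻¹ : (ZMod q)ˣ) : ZMod q))‖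
        ≤ C₃ * (R * (q : ℝ) ^ (ε + η / 4)) := by
    intro i j
    have hRHS : 0 ≤ C₃ * (R * (q : ℝ) ^ (ε + η / 4)) := by positivity
    rcases (dyadicUnits q i).eq_empty_or_nonempty with hi | hi
    · simpa [hi] using hRHS
    rcases (dyadicUnits q j).eq_empty_or_nonempty with hj | ⟨y₀, hj⟩
    · simpa [dyadicReciprocalSum, hj] using hRHS
    refine le_of_pow_le_mul hr1 hC₃1 (Nat.cast_nonneg _) (Nat.cast_nonneg _) (Nat.cast_nonneg _)
      hq0 ?_
    have hX : (2 : ℝ) ^ (j + 1) ≤ q := by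
      exact_mod_cast two_pow_succ_le_of_mem_dyadicUnits hq1 hj
    -- The scale is j + 1 because residues in block j are bounded by 2^(j+1).
    have hJ := hE q hQq hqQ hqE (j + 1) (hX.trans hqQ)
    set b : ℝ := min (N : ℝ) (q / 2 ^ j) with hb
    have hb0 : 0 ≤ b := le_min (Nat.cast_nonneg _) (by positivity)
    have hmom := sum_norm_pow_le (r := r) (X := 2 ^ (j + 1)) (dyadicUnits q j)
      (fun y hy => ⟨valMinAbs_unit_ne_zero hq1 y, abs_valMinAbs_le_of_mem_dyadicUnits hy⟩)
      (fun y hy => neg_mem_dyadicUnits hy)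
      (fun y => ∑ n ∈ consecutive w N, ZMod.stdAddChar ((n : ZMod q) * (y : ZMod q))) hb0
      (fun y hy => norm_sum_consecutive_le_min hq1 w N hy)
    have hnum := mul_pow_mul_le_of_le hr1 hQ0 hq0 hqQ hb0 (min_le_left _ _)
      (show (0 : ℝ) ≤ 2 ^ (j + 1) by positivity) (by
        calc b * 2 ^ (j + 1) ≤ q / 2 ^ j * 2 ^ (j + 1) := by gcongr; exact min_le_right _ _
          _ = 2 * q := by rw [pow_succ]; field_simp) (by positivity) hJ
    have hratio := hC₁ q hq1 i hi u L I (Finset.filter_subset _ _)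
      (fun l hl => (Finset.mem_filter.mp hl).2) (fun t => ‖dyadicReciprocalSum q w N j t‖)
      (fun _ => norm_nonneg _) (min (M : ℝ) (q / 2 ^ i)) M
      (le_min (Nat.cast_nonneg _) (by positivity)) (min_le_left _ _) (by
        calc min (M : ℝ) (q / 2 ^ i) * 2 ^ i ≤ q / 2 ^ i * 2 ^ i := by
              gcongr; exact min_le_right _ _
          _ = q := by field_simp)
    refine hratio.trans ?_
    have hQε : Q ^ (2 * (r : ℝ) * ε) ≤ (q : ℝ) ^ (2 * (r : ℝ) * ε) := by gcongr
    have hF : ∑ t, ‖dyadicReciprocalSum q w N j t‖ ^ (2 * r)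
        ≤ 2 * 4 ^ r * q * ((N : ℝ) ^ r * q ^ r + q ^ (2 * r - 1)) * q ^ (2 * (r : ℝ) * ε) := by
      refine (hmom.trans hnum).trans ?_
      gcongr
    have e1 : (q : ℝ) ^ (4 * r - 1) = (q : ℝ) ^ (2 * r - 1) * q * (q : ℝ) ^ (2 * r - 1) := by
      rw [← pow_succ, ← pow_add]; congr 1; omega
    have e2 : (q : ℝ) ^ (3 * r) = (q : ℝ) ^ (2 * r - 1) * q * (q : ℝ) ^ r := by
      rw [← pow_succ, ← pow_add]; congr 1; omega
    have e3 : (q : ℝ) ^ (2 * r * (ε + η / 4)) = (q : ℝ) ^ δ * (q : ℝ) ^ (2 * (r : ℝ) * ε) := by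
      rw [← Real.rpow_add hq0, hδ]; congr 1; ring
    calc _ ≤ C₁ * (q : ℝ) ^ δ * ((L : ℝ) ^ (2 * r - 1) * (L + M)) * (q : ℝ) ^ (2 * r - 1)
          * (2 * 4 ^ r * q * ((N : ℝ) ^ r * q ^ r + q ^ (2 * r - 1)) * q ^ (2 * (r : ℝ) * ε)) := by
          gcongr
      _ = _ := by rw [e1, e2, e3, hC₃]; ring
  calc ‖trilinearKloosterman q α u v w L M N‖
      ≤ ∑ i ∈ Finset.range (Nat.log 2 q + 1), ∑ j ∈ Finset.range (Nat.log 2 q + 1),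
          C₃ * (R * (q : ℝ) ^ (ε + η / 4)) :=
        (norm_trilinearKloosterman_le hq1 α u v w L M N hα hα0).trans
          (Finset.sum_le_sum fun i _ => Finset.sum_le_sum fun j _ => hblock i j)
    _ = ((Nat.log 2 q : ℝ) + 1) ^ 2 * (C₃ * (R * (q : ℝ) ^ (ε + η / 4))) := by
        simp; ring
    _ ≤ (C₂ * (q : ℝ) ^ (η / 4)) ^ 2 * (C₃ * (R * (q : ℝ) ^ (ε + η / 4))) := by
        gcongr
        exact hC₂ q hq1.le
    _ = (C₂ ^ 2 * C₃) * (R * ((q : ℝ) ^ (η / 4) * (q : ℝ) ^ (η / 4) * (q : ℝ) ^ (ε + η / 4))) := by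
        ring
    _ ≤ (q : ℝ) ^ (η / 4) *
          (R * ((q : ℝ) ^ (η / 4) * (q : ℝ) ^ (η / 4) * (q : ℝ) ^ (ε + η / 4))) := by
        gcongr
    _ = R * (q : ℝ) ^ (ε + η) := by
        have : (q : ℝ) ^ (ε + η) = (q : ℝ) ^ (η / 4) *
            ((q : ℝ) ^ (η / 4) * (q : ℝ) ^ (η / 4) * (q : ℝ) ^ (ε + η / 4)) := by
          simp only [← Real.rpow_add hq0]; congr 1; ring
        rw [this]; ring
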